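/- Let $V$ be a finite dimensional vector space over a field $k$, let $0\ne q\in k$, and let $R:V\otimes V\to V\otimes V$ be a Hecke symmetry with parameter $q$, i.e. a linear operator satisfying the braid equation $(R\otimes\mathrm{Id})(\mathrm{Id}\otimes R)(R\otimes\mathrm{Id})=(\mathrm{Id}\otimes R)(R\otimes\mathrm{Id})(\mathrm{Id}\otimes R)$ and $(R-q\,\mathrm{Id})(R+\mathrm{Id})=0$. Let $T(V)$ be the tensor algebra with homogeneous components $T_m(V)=V^{\otimes m}$, products being written without the sign $\otimes$. On $V^{\otimes m}$ put $T_i=\mathrm{Id}^{\otimes(i-1)}\otimes R\otimes\mathrm{Id}^{\otimes(m-i-1)}$ for $1\le i<m$. For $\sigma\in\mathfrak S_m$ let $\ell(\sigma)$ be the number of inversions of $\sigma$, and put $T_\sigma=T_{i_1}\cdots T_{i_r}$ for any reduced expression $\sigma=\tau_{i_1}\cdots\tau_{i_r}$ through the basic transpositions $\tau_i=(i,i+1)$. Put $$y_m=\sum_{\sigma\in\mathfrak S_m}(-1)^{\ell(\sigma)}q^{m(m-1)/2-\ell(\sigma)}T_\sigma,\qquad y_{a+b/a,b}=\sum_{d}(-1)^{\ell(d)}q^{ab-\ell(d)}T_d,$$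 where $d$ runs over the permutations in $\mathfrak S_{a+b}$ which are increasing on $\{1,\dots,a\}$ and on $\{a+1,\dots,a+b\}$. Let $I$ be the ideal of $T(V)$ generated by $\mathrm{Ker}(R-q\,\mathrm{Id})\subset V^{\otimes2}$, with homogeneous components $I_m$, and let $\Lambda(V,R)=T(V)/I$. Let $\Upsilon^{(m)}=\bigcap_{i=1}^{m-1}(T_i-q)V^{\otimes m}$ (so $\Upsilon^{(0)}=k$, $\Upsilon^{(1)}=V$), and let $\Upsilon(V,R)=\bigoplus_{m\ge0}\Upsilon^{(m)}$ be the graded algebra with multiplication $a\star b=y_{i+j/i,j}(ab)$ for $a\in\Upsilon^{(i)}$, $b\in\Upsilon^{(j)}$. Assume that $n>0$, $\dim\Upsilon^{(n)}=1$, $\Upsilon^{(n+1)}=0$ and $y_nV^{\otimes n}\ne0$. Let $f$ be a linear function on $T_n(V)$ such that $\mathrm{Ker}\,f=\{u\in T_n(V)\mid y_nu=0\}$. Put $I'=\bigoplus_{i\ge0}I'_i$, where $$I'_i=\{u\in T_i(V)\mid f(uw)=0\ \text{for all}\ w\in T_{n-i}(V)\}\quad(0\le i\le n),\qquad I'_i=T_i(V)\quad(i>n).$$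 Then the following hold. 1. There is a unique automorphism $\nu$ of the graded algebra $\Upsilon(V,R)$ (the Nakayama automorphism) such that $b\star a=\nu(a)\star b$ whenever $0\le i\le n$, $a\in\Upsilon^{(i)}$, $b\in\Upsilon^{(n-i)}$. Its restriction $\varphi$ to $\Upsilon^{(1)}=V$ is an invertible linear operator, and $f$ is twisted-cyclic: $f(wv)=f(\varphi(v)w)$ for all $v\in V$ and $w\in T_{n-1}(V)$. 2. $I'$ is a graded two-sided ideal of $T(V)$ with $I'_0=I'_1=0$ and $I'_2=I_2$. The algebra $T(V)/I'$ is Frobenius (finite dimensional, with a linear function $l$ for which the bilinear form $(a,b)\mapsto l(ab)$ is nondegenerate), and it is isomorphic to $\Upsilon(V,R)$ as a graded algebra. 3. If $[n]!_q=\prod_{m=1}^n(1+q+\cdots+q^{m-1})\ne0$, then $I'=I$. -/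

import Mathlib

open scoped TensorProduct

namespace HeckeSym

noncomputable section

/-! ### Inversions and descents in the symmetric group -/

/-- The number of inversions of `σ`, which is its Coxeter length `ℓ(σ)`. -/
def len {n : ℕ} (σ : Equiv.Perm (Fin n)) : ℕ :=
  (Finset.univ.filter fun p : Fin n × Fin n => p.1 < p.2 ∧ σ p.2 < σ p.1).card

/-- The basic transposition exchanging the neighbouring positions `i` and `i + 1`
(positions are counted from `0`). -/
def adj {n : ℕ} (i : ℕ) (h : i + 1 < n) : Equiv.Perm (Fin n) :=
  Equiv.swap ⟨i, Nat.lt_of_succ_lt h⟩ ⟨i + 1, h⟩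

/-- `σ` has a descent at `i`: `σ(i) > σ(i + 1)`. -/
def IsDescent {n : ℕ} (σ : Equiv.Perm (Fin n)) (i : ℕ) : Prop :=
  ∃ h : i + 1 < n, σ ⟨i + 1, h⟩ < σ ⟨i, Nat.lt_of_succ_lt h⟩

/-- Multiplying on the right by `τ_i` at a descent decreases the length. -/
theorem len_mul_adj_lt {n : ℕ} (σ : Equiv.Perm (Fin n)) (i : ℕ) (h : IsDescent σ i) :
    len (σ * adj i h.choose) < len σ := by
  obtain ⟨hi, hd⟩ := id h
  have hch : adj i h.choose = adj i hi := rfl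
  rw [hch]
  set a : Fin n := ⟨i, Nat.lt_of_succ_lt hi⟩ with ha
  set b : Fin n := ⟨i + 1, hi⟩ with hb
  have hab : a < b := by simp [ha, hb, Fin.lt_def]
  have hadj : adj i hi = Equiv.swap a b := rfl
  rw [hadj]
  unfold len
  have key : ∀ x y : Fin n, x < y → ¬ (x = a ∧ y = b) →
      Equiv.swap a b x < Equiv.swap a b y := by
    intro x y hxy hne
    have hav : (a : ℕ) = i := rfl
    have hbv : (b : ℕ) = i + 1 := rfl
    simp only [Equiv.swap_apply_def]
    simp only [Fin.lt_def, Fin.ext_iff] at *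
    split_ifs <;> omega
  rw [← Finset.card_map ((Equiv.swap a b).prodCongr (Equiv.swap a b)).toEmbedding]
  apply Finset.card_lt_card
  rw [Finset.ssubset_iff_of_subset]
  · refine ⟨(a, b), by simp [hab, hd], ?_⟩
    simp only [Finset.mem_map, Finset.mem_filter, Finset.mem_univ, true_and, not_exists, not_and]
    rintro ⟨x, y⟩ ⟨h1, h2⟩ h3
    simp only [Equiv.toEmbedding_apply, Equiv.prodCongr_apply, Prod.map_apply,
      Prod.mk.injEq] at h3
    obtain ⟨h4, h5⟩ := h3
    have hx : x = b := by
      apply (Equiv.swap a b).injective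
      simpa using h4
    have hy : y = a := by
      apply (Equiv.swap a b).injective
      simpa using h5
    subst hx hy
    exact absurd h1 (not_lt.mpr hab.le)
  · intro p hp
    simp only [Finset.mem_map, Finset.mem_filter, Finset.mem_univ, true_and] at hp ⊢
    obtain ⟨⟨x, y⟩, ⟨h1, h2⟩, rfl⟩ := hp
    simp only [Equiv.toEmbedding_apply, Equiv.prodCongr_apply, Prod.map_apply]
    refine ⟨key x y h1 ?_, by simpa using h2⟩
    rintro ⟨rfl, rfl⟩
    simp only [Equiv.Perm.mul_apply, Equiv.swap_apply_left, Equiv.swap_apply_right] at h2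
    exact absurd h2 (not_lt.mpr hd.le)

/-! ### The tensor algebra and the action of a Hecke symmetry -/

section

variable (k V : Type*) [Field k] [AddCommGroup V] [Module k V]

/-- The homogeneous component `T_n(V) = V^{⊗n}` of the tensor algebra. -/
abbrev tens (n : ℕ) : Submodule k (TensorAlgebra k V) :=
  LinearMap.range (TensorAlgebra.ι k : V →ₗ[k] TensorAlgebra k V) ^ n

instance : GradedAlgebra (tens k V) := TensorAlgebra.gradedAlgebra

variable {k V}

theorem mul_mem_tens {a b n : ℕ} (h : a + b = n) {u w : TensorAlgebra k V}
    (hu : u ∈ tens k V a) (hw : w ∈ tens k V b) : u * w ∈ tens k V n :=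
  h ▸ SetLike.mul_mem_graded (A := tens k V) hu hw

theorem ι_mem_tens (v : V) : TensorAlgebra.ι k v ∈ tens k V 1 := by
  rw [tens, pow_one]; exact LinearMap.mem_range_self _ v

variable (k V)

/-- The linear map `V ⊗ T(V) → T(V)`, `v ⊗ x ↦ v x`. -/
def glue : V ⊗[k] TensorAlgebra k V →ₗ[k] TensorAlgebra k V :=
  TensorProduct.lift ((LinearMap.mul k (TensorAlgebra k V)) ∘ₗ TensorAlgebra.ι k)

/-- The linear map `V ⊗ V → T(V)`, `v ⊗ w ↦ v w`, which identifies `V ⊗ V` with `T_2(V)`. -/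
def glueTwo : V ⊗[k] V →ₗ[k] TensorAlgebra k V :=
  glue k V ∘ₗ LinearMap.lTensor V (TensorAlgebra.ι k)

/-- Auxiliary representation of `T(V)` on `T(V) × (V ⊗ T(V))`, where `v ∈ V` acts by
`(x, z) ↦ (v x, v ⊗ x)`. -/
def cutRep : TensorAlgebra k V →ₐ[k]
    Module.End k (TensorAlgebra k V × (V ⊗[k] TensorAlgebra k V)) :=
  TensorAlgebra.lift k
    { toFun := fun v =>
        (LinearMap.prod (LinearMap.mulLeft k (TensorAlgebra.ι k v))
          (TensorProduct.mk k V (TensorAlgebra k V) v)) ∘ₗ LinearMap.fst k _ _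
      map_add' := by intro v w; ext <;> simp [add_mul]
      map_smul' := by intro c v; ext <;> simp [TensorProduct.smul_tmul'] }

/-- The linear map `T(V) → V ⊗ T(V)` which splits off the first tensor factor:
`v x ↦ v ⊗ x` and `1 ↦ 0`. -/
def cut : TensorAlgebra k V →ₗ[k] V ⊗[k] TensorAlgebra k V :=
  { toFun := fun x => (cutRep k V x (1, 0)).2
    map_add' := by intro x y; simp
    map_smul' := by intro c x; simp }

variable {k V}

theorem cutRep_fst (x : TensorAlgebra k V) : (cutRep k V x (1, 0)).1 = x := by
  have h : ∀ y : TensorAlgebra k V × (V ⊗[k] TensorAlgebra k V),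
      (cutRep k V x y).1 = x * y.1 := by
    induction x using TensorAlgebra.induction with
    | algebraMap r => intro y; simp [Algebra.algebraMap_eq_smul_one]
    | ι v => intro y; simp [cutRep]
    | mul a b ha hb => intro y; simp [ha, hb, mul_assoc]
    | add a b ha hb => intro y; simp [ha, hb, add_mul]
  simpa using h (1, 0)

theorem cut_ι_mul (v : V) (x : TensorAlgebra k V) :
    cut k V (TensorAlgebra.ι k v * x) = v ⊗ₜ[k] x := by
  have h : (cutRep k V (TensorAlgebra.ι k v * x) (1, 0)).2
      = v ⊗ₜ[k] (cutRep k V x (1, 0)).1 := by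
    rw [map_mul]; simp [cutRep]
  rw [cutRep_fst] at h
  exact h

theorem cut_one : cut k V 1 = 0 := by simp [cut]

/-- The action of `R` on the tensor factors in the positions `i` and `i + 1` (counted from `0`)
of tensors of degree at least `i + 2`; on `T_m(V)` with `m < i + 2` it is `0`. So for `i < n - 1`
the operator `act R i` restricts on `T_n(V)` to
`Id^{⊗ i} ⊗ R ⊗ Id^{⊗ (n - i - 2)}`, the action of the generator `T_{i+1}` of the Hecke algebra. -/
def act (R : V ⊗[k] V →ₗ[k] V ⊗[k] V) : ℕ → Module.End k (TensorAlgebra k V)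
  | 0 => glue k V ∘ₗ LinearMap.lTensor V (glue k V) ∘ₗ
      (TensorProduct.assoc k V V (TensorAlgebra k V)).toLinearMap ∘ₗ
      LinearMap.rTensor (TensorAlgebra k V) R ∘ₗ
      (TensorProduct.assoc k V V (TensorAlgebra k V)).symm.toLinearMap ∘ₗ
      LinearMap.lTensor V (cut k V) ∘ₗ cut k V
  | i + 1 => glue k V ∘ₗ LinearMap.lTensor V (act R i) ∘ₗ cut k V

/-- `act R i` is indeed `Id^{⊗ i} ⊗ R ⊗ Id`. -/
theorem act_apply (R : V ⊗[k] V →ₗ[k] V ⊗[k] V) (i : ℕ) {a : TensorAlgebra k V}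
    (ha : a ∈ tens k V i) (x : V ⊗[k] V) (b : TensorAlgebra k V) :
    act R i (a * (glueTwo k V x * b)) = a * (glueTwo k V (R x) * b) := by
  have h0 : ∀ y : V ⊗[k] V, glue k V (LinearMap.lTensor V (glue k V)
      (TensorProduct.assoc k V V (TensorAlgebra k V) (y ⊗ₜ[k] b))) = glueTwo k V y * b := by
    intro y
    induction y using TensorProduct.induction_on with
    | zero => simp
    | tmul v w => simp [glue, glueTwo, mul_assoc]
    | add y z hy hz => simp [TensorProduct.add_tmul, add_mul, hy, hz]
  have h1 : LinearMap.lTensor V (cut k V) (cut k V (glueTwo k V x * b))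
      = TensorProduct.assoc k V V (TensorAlgebra k V) (x ⊗ₜ[k] b) := by
    induction x using TensorProduct.induction_on with
    | zero => simp
    | tmul v w => simp [glue, glueTwo, mul_assoc, cut_ι_mul]
    | add y z hy hz => simp [add_mul, TensorProduct.add_tmul, hy, hz]
  induction ha using Submodule.pow_induction_on_left' with
  | algebraMap r =>
    have : act R 0 (glueTwo k V x * b) = glueTwo k V (R x) * b := by
      simp only [act, LinearMap.comp_apply, h1]
      simp [h0]
    simp [Algebra.algebraMap_eq_smul_one, this]
  | add a c i _ _ iha ihc => simp [add_mul, iha, ihc]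
  | mem_mul m hm i a _ ih =>
    obtain ⟨v, rfl⟩ := hm
    rw [mul_assoc, mul_assoc, ← ih]
    simp [act, cut_ι_mul, glue]

/-- A Hecke symmetry on `V` with parameter `q ≠ 0`. -/
structure IsHeckeSymmetry (R : V ⊗[k] V →ₗ[k] V ⊗[k] V) (q : k) : Prop where
  ne_zero : q ≠ 0
  braid :
    let R₁ : Module.End k (V ⊗[k] V ⊗[k] V) := LinearMap.rTensor V R
    let R₂ : Module.End k (V ⊗[k] V ⊗[k] V) :=
      (TensorProduct.assoc k V V V).symm.toLinearMap ∘ₗ LinearMap.lTensor V R ∘ₗ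
        (TensorProduct.assoc k V V V).toLinearMap
    R₁ ∘ₗ R₂ ∘ₗ R₁ = R₂ ∘ₗ R₁ ∘ₗ R₂
  hecke : (R - q • LinearMap.id) ∘ₗ (R + LinearMap.id) = 0

open Classical in
/-- The operator by which the standard basis element `T_σ` of the Hecke algebra acts on tensors
of degree at least `n`. It is the composite `T_{i_1} ⋯ T_{i_m}` for a reduced expression
`σ = τ_{i_1} ⋯ τ_{i_m}`, which is built from the right: if `σ` has a descent at `i`, then
`T_σ = T_{σ τ_i} T_i`, and `T_e = 1`. (Different choices of descents give the same operator on
these tensors, as the braid relations hold there.) -/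
def heckeOp (R : V ⊗[k] V →ₗ[k] V ⊗[k] V) {n : ℕ} (σ : Equiv.Perm (Fin n)) :
    Module.End k (TensorAlgebra k V) :=
  if h : ∃ i, IsDescent σ i then
    heckeOp R (σ * adj h.choose h.choose_spec.choose) * act R h.choose
  else 1
termination_by len σ
decreasing_by exact len_mul_adj_lt σ _ h.choose_spec

/-- The antisymmetrizer `y_n = ∑_σ (-1)^{ℓ(σ)} q^{ℓ_n - ℓ(σ)} T_σ`, `ℓ_n = n (n - 1) / 2`. -/
def antisym (R : V ⊗[k] V →ₗ[k] V ⊗[k] V) (q : k) (n : ℕ) : Module.End k (TensorAlgebra k V) :=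
  ∑ σ : Equiv.Perm (Fin n), ((-1) ^ len σ * q ^ (n * (n - 1) / 2 - len σ)) • heckeOp R σ

/-- The permutations of `{0, …, a + b - 1}` which are increasing on the first `a` and on the last
`b` positions: the distinguished representatives of the cosets `S_{a+b} / S_{a,b}`. -/
def IsShuffle (a b : ℕ) (σ : Equiv.Perm (Fin (a + b))) : Prop :=
  ∀ i j : Fin (a + b), i < j → ((j : ℕ) < a ∨ a ≤ (i : ℕ)) → σ i < σ j

open Classical in
/-- The partial antisymmetrizer
`y_{a+b/a,b} = ∑_d (-1)^{ℓ(d)} q^{ab - ℓ(d)} T_d`, the sum being over the distinguished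
representatives of the cosets `S_{a+b} / S_{a,b}`. -/
def shuffleAntisym (R : V ⊗[k] V →ₗ[k] V ⊗[k] V) (q : k) (a b : ℕ) :
    Module.End k (TensorAlgebra k V) :=
  ∑ d : Equiv.Perm (Fin (a + b)) with IsShuffle a b d,
    ((-1) ^ len d * q ^ (a * b - len d)) • heckeOp R d

/-! ### The graded algebra `Υ(V,R)` -/

/-- The subspace `Υ^{(n)} = ⋂_{i=1}^{n-1} (T_i - q) V^{⊗n}` of `T_n(V)`; the empty intersection
for `n ≤ 1` is the whole `T_n(V)`. -/
def upsilon (R : V ⊗[k] V →ₗ[k] V ⊗[k] V) (q : k) (n : ℕ) : Submodule k (TensorAlgebra k V) :=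
  tens k V n ⊓ ⨅ i ∈ Finset.range (n - 1), (tens k V n).map (act R i - q • 1)

/-- The underlying space `Υ(V,R) = ⨁ Υ^{(n)}` inside `T(V)`. -/
def Upsilon (R : V ⊗[k] V →ₗ[k] V ⊗[k] V) (q : k) : Submodule k (TensorAlgebra k V) :=
  ⨆ n, upsilon R q n

/-- The bilinear multiplication `⋆` with `a ⋆ b = y_{i+j/i,j} (a b)` for `a` of degree `i` and
`b` of degree `j`. The multiplication of `Υ(V,R)` is its restriction. -/
def starMul (R : V ⊗[k] V →ₗ[k] V ⊗[k] V) (q : k) :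
    TensorAlgebra k V →ₗ[k] TensorAlgebra k V →ₗ[k] TensorAlgebra k V :=
  (DirectSum.toModule k ℕ (TensorAlgebra k V →ₗ[k] TensorAlgebra k V) fun i =>
    LinearMap.flip
      ((DirectSum.toModule k ℕ (tens k V i →ₗ[k] TensorAlgebra k V) fun j =>
        LinearMap.flip (((LinearMap.mul k (TensorAlgebra k V)).compr₂
          (shuffleAntisym R q i j)).domRestrict₁₂ (tens k V i) (tens k V j))) ∘ₗ
        (DirectSum.decomposeLinearEquiv (tens k V)).toLinearMap)) ∘ₗ
    (DirectSum.decomposeLinearEquiv (tens k V)).toLinearMap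

theorem starMul_apply (R : V ⊗[k] V →ₗ[k] V ⊗[k] V) (q : k) {i j : ℕ} {a b : TensorAlgebra k V}
    (ha : a ∈ tens k V i) (hb : b ∈ tens k V j) :
    starMul R q a b = shuffleAntisym R q i j (a * b) := by
  simp only [starMul, LinearMap.comp_apply, LinearEquiv.coe_coe,
    DirectSum.decomposeLinearEquiv_apply,
    DirectSum.decompose_of_mem _ ha]
  rw [← DirectSum.lof_eq_of k, DirectSum.toModule_lof]
  simp only [LinearMap.flip_apply, LinearMap.comp_apply, LinearEquiv.coe_coe,
    DirectSum.decomposeLinearEquiv_apply, DirectSum.decompose_of_mem _ hb]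
  rw [← DirectSum.lof_eq_of k, DirectSum.toModule_lof]
  rfl

theorem one_mem_Upsilon (R : V ⊗[k] V →ₗ[k] V ⊗[k] V) (q : k) :
    (1 : TensorAlgebra k V) ∈ Upsilon R q :=
  Submodule.mem_iSup_of_mem 0 (by simp [upsilon, Submodule.one_eq_range])

theorem ι_mem_Upsilon (R : V ⊗[k] V →ₗ[k] V ⊗[k] V) (q : k) (v : V) :
    TensorAlgebra.ι k v ∈ Upsilon R q :=
  Submodule.mem_iSup_of_mem 1 (by simp [upsilon])

/-- `ν` is the Nakayama automorphism of the graded Frobenius algebra `Υ(V,R)` with last nonzero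
component `Υ^{(n)}`: an automorphism of graded algebras such that `b ⋆ a = ν(a) ⋆ b` for
`a ∈ Υ^{(i)}` and `b ∈ Υ^{(n-i)}`. -/
structure IsNakayama (R : V ⊗[k] V →ₗ[k] V ⊗[k] V) (q : k) (n : ℕ)
    (ν : Upsilon R q ≃ₗ[k] Upsilon R q) : Prop where
  map_one : ν ⟨1, one_mem_Upsilon R q⟩ = ⟨1, one_mem_Upsilon R q⟩
  map_star : ∀ a b c : Upsilon R q, (c : TensorAlgebra k V) = starMul R q a b →
    (ν c : TensorAlgebra k V) = starMul R q (ν a) (ν b)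
  map_degree : ∀ (i : ℕ) (a : Upsilon R q), (a : TensorAlgebra k V) ∈ upsilon R q i →
    (ν a : TensorAlgebra k V) ∈ upsilon R q i
  comm : ∀ i ≤ n, ∀ a b : Upsilon R q, (a : TensorAlgebra k V) ∈ upsilon R q i →
    (b : TensorAlgebra k V) ∈ upsilon R q (n - i) →
    starMul R q (b : TensorAlgebra k V) a = starMul R q (ν a : TensorAlgebra k V) b

/-- An isomorphism of graded algebras `T(V)/J ≅ Υ(V,R)`, where `J` is a two-sided ideal. -/
structure IsIsoUpsilon (R : V ⊗[k] V →ₗ[k] V ⊗[k] V) (q : k) (J : Ideal (TensorAlgebra k V))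
    [J.IsTwoSided] (e : (TensorAlgebra k V ⧸ J) ≃ₗ[k] Upsilon R q) : Prop where
  map_one : (e 1 : TensorAlgebra k V) = 1
  map_mul : ∀ a b, (e (a * b) : TensorAlgebra k V) = starMul R q (e a) (e b)
  map_degree : ∀ i, ∀ u ∈ tens k V i,
    (e (Ideal.Quotient.mk J u) : TensorAlgebra k V) ∈ upsilon R q i

/-! ### Frobenius algebras and the ideals -/

/-- The two-sided ideal `I` of `T(V)`, generated by `Ker (R - q Id) ⊆ V ⊗ V`, which defines the
`R`-skewsymmetric algebra `Λ(V,R) = T(V)/I`. -/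
def skewIdeal (R : V ⊗[k] V →ₗ[k] V ⊗[k] V) (q : k) : Ideal (TensorAlgebra k V) :=
  TwoSidedIdeal.asIdeal (TwoSidedIdeal.span
    (glueTwo k V '' (LinearMap.ker (R - q • LinearMap.id) : Set (V ⊗[k] V))))

/-- The left radical of the pairing `T_i(V) × T_{n-i}(V) → k`, `(u, w) ↦ f(u w)`, for `i ≤ n`;
for `i > n` it is the whole `T_i(V)`. -/
def radical {n : ℕ} (f : tens k V n →ₗ[k] k) (i : ℕ) : Submodule k (TensorAlgebra k V) where
  carrier := {u | ∃ hu : u ∈ tens k V i, ∀ (j : ℕ) (h : i + j = n),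
    ∀ w : tens k V j, f ⟨u * w, mul_mem_tens h hu w.2⟩ = 0}
  zero_mem' := by
    refine ⟨zero_mem _, fun j h w => ?_⟩
    have : (⟨0 * (w : TensorAlgebra k V), mul_mem_tens h (zero_mem _) w.2⟩ : tens k V n) = 0 := by
      ext; simp
    rw [this, map_zero]
  add_mem' := by
    rintro u v ⟨hu, hu'⟩ ⟨hv, hv'⟩
    refine ⟨add_mem hu hv, fun j h w => ?_⟩
    have : (⟨(u + v) * (w : TensorAlgebra k V), mul_mem_tens h (add_mem hu hv) w.2⟩ : tens k V n)
        = ⟨u * w, mul_mem_tens h hu w.2⟩ + ⟨v * w, mul_mem_tens h hv w.2⟩ := by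
      ext; simp [add_mul]
    rw [this, map_add, hu' j h, hv' j h, add_zero]
  smul_mem' := by
    rintro c u ⟨hu, hu'⟩
    refine ⟨Submodule.smul_mem _ c hu, fun j h w => ?_⟩
    have : (⟨(c • u) * (w : TensorAlgebra k V),
        mul_mem_tens h (Submodule.smul_mem _ c hu) w.2⟩ : tens k V n)
        = c • ⟨u * w, mul_mem_tens h hu w.2⟩ := by
      ext; simp
    rw [this, map_smul, hu' j h, smul_zero]

/-- `I' = ⨁ I'_i`. -/
def radicalSum {n : ℕ} (f : tens k V n →ₗ[k] k) : Submodule k (TensorAlgebra k V) :=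
  ⨆ i, radical f i

/-- The `q`-factorial `[n]!_q = ∏_{m=1}^n (1 + q + ⋯ + q^{m-1})`. -/
def qFactorial (q : k) (n : ℕ) : k := ∏ m ∈ Finset.Icc 1 n, ∑ i ∈ Finset.range m, q ^ i

end

/-- A Frobenius algebra over a field: a finite dimensional algebra with a linear function `l`
such that the bilinear form `(a, b) ↦ l(ab)` is nondegenerate. -/
def IsFrobenius (k A : Type*) [Field k] [Ring A] [Algebra k A] : Prop :=
  FiniteDimensional k A ∧
    ∃ l : A →ₗ[k] k, ((LinearMap.mul k A).compr₂ l).Nondegenerate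

end

end HeckeSym

namespace HeckeSym

noncomputable section

variable {k V : Type*} [Field k] [AddCommGroup V] [Module k V]

section

/-! ### Tensor calculus -/

/-! The partial antisymmetrizers obey a q-Pascal recursion: the value 0 of a shuffle sits at the
first position of one of its two blocks, and removing it leaves a smaller shuffle. Contracting the
first tensor factor with linear functions turns this into inductions on the degree
(`contr_splitAntisym`). Three facts come out of it. First, y_{i+j}(uw) = y_{i+j/i,j}(y_i u · y_j w)
(`antisym_mul`), so the operators y_m together are multiplicative from T(V) to the product ⋆.
Second, Υ is closed under ⋆ (`splitAntisym_mul_mem_upsilon`), so by induction the image of this map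
lies in Υ. Third, the pairing of Υ^{(i)} with y_j V^{⊗j}, i + j = n, has no left radical
(`eq_zero_of_splitAntisym_eq_zero`): if a ∈ Υ^{(i+1)} kills y_j V^{⊗j}, then contracting 0 = a ⋆
y_{j+1}w ∈ Υ^{(n+1)} shows that every contraction of a kills y_{j+1}V^{⊗(j+1)}, and the descent ends
at scalars, where y_n ≠ 0 decides.

Since dim Υ^{(n)} = 1, this gives dim Υ^{(i)} ≤ dim y_j V^{⊗j} ≤ dim Υ^{(j)} ≤ dim y_i V^{⊗i} ≤ dim
Υ^{(i)}, so T(V) → Υ is onto (`map_antisym_eq_upsilon`). As Ker f = Ker y_n, nondegeneracy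
identifies I'_i with Ker y_i (`mem_radical_iff_antisym`). Thus I' is the kernel of T(V) → Υ, and f
induces a Frobenius form on the quotient. The general Nakayama automorphism of this form respects
degrees because f lives in the single degree n; transported to Υ it gives ν, and its degree 1 part
is φ.

In degree 2 one has y_2 = q - R, so I'_2 = I_2 and I ⊆ I'. Modulo I every T_i acts as -1, hence y_m
acts as [m]!_q. When [n]!_q ≠ 0 this yields Ker y_m ⊆ I for m ≤ n. Above n it remains to see
T_{n+1}(V) ⊆ I: modulo I the space T_n(V) is spanned by one tensor, and evaluating v w v' in two
ways shows that either T_{n+1}(V) ⊆ I or dim V ≤ 1, a case settled directly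
(`tens_succ_le_skewIdeal`). -/

@[elab_as_elim]
theorem tens_succ_induction {n : ℕ} {P : TensorAlgebra k V → Prop}
    (hmul : ∀ (v : V), ∀ y ∈ tens k V n, P (TensorAlgebra.ι k v * y))
    (hadd : ∀ x y, P x → P y → P (x + y)) {x : TensorAlgebra k V} (hx : x ∈ tens k V (n + 1)) :
    P x := by
  rw [tens, pow_succ'] at hx
  refine Submodule.mul_induction_on hx ?_ hadd
  rintro _ ⟨v, rfl⟩ y hy
  exact hmul v y hy

@[elab_as_elim]
theorem tens_mul_induction {m n : ℕ} {P : TensorAlgebra k V → Prop}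
    (hmul : ∀ u ∈ tens k V m, ∀ w ∈ tens k V n, P (u * w))
    (hadd : ∀ x y, P x → P y → P (x + y)) {x : TensorAlgebra k V} (hx : x ∈ tens k V (m + n)) :
    P x := by
  rw [tens, pow_add] at hx
  exact Submodule.mul_induction_on hx hmul hadd

theorem mem_tens_zero {x : TensorAlgebra k V} (hx : x ∈ tens k V 0) :
    ∃ c : k, x = c • 1 := by
  rw [tens, pow_zero, Submodule.mem_one] at hx
  obtain ⟨c, rfl⟩ := hx
  exact ⟨c, Algebra.algebraMap_eq_smul_one c⟩

theorem one_mem_tens : (1 : TensorAlgebra k V) ∈ tens k V 0 := SetLike.one_mem_graded _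

theorem ι_mul_mem_tens (v : V) {n : ℕ} {x : TensorAlgebra k V} (hx : x ∈ tens k V n) :
    TensorAlgebra.ι k v * x ∈ tens k V (n + 1) :=
  mul_mem_tens (add_comm 1 n) (ι_mem_tens v) hx

theorem mem_tens_one {x : TensorAlgebra k V} (hx : x ∈ tens k V 1) :
    ∃ v : V, x = TensorAlgebra.ι k v := by
  rw [tens, pow_one] at hx
  obtain ⟨v, rfl⟩ := hx
  exact ⟨v, rfl⟩

theorem linearMap_ext_tens {M : Type*} [AddCommGroup M] [Module k M]
    {X Y : TensorAlgebra k V →ₗ[k] M}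
    (h : ∀ n, ∀ x ∈ tens k V n, X x = Y x) : X = Y := by
  ext1 x
  induction x using DirectSum.Decomposition.inductionOn (tens k V) with
  | zero => simp
  | homogeneous x => exact h _ _ x.2
  | add x y hx hy => simp [hx, hy]

theorem glueTwo_tmul (v w : V) :
    glueTwo k V (v ⊗ₜ w) = TensorAlgebra.ι k v * TensorAlgebra.ι k w := by
  simp [glueTwo, glue]

theorem glueTwo_mem_tens (z : V ⊗[k] V) : glueTwo k V z ∈ tens k V 2 := by
  induction z using TensorProduct.induction_on with
  | zero => simp
  | tmul v w =>
    rw [glueTwo_tmul]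
    exact mul_mem_tens rfl (ι_mem_tens v) (ι_mem_tens w)
  | add x y hx hy => rw [map_add]; exact add_mem hx hy

@[elab_as_elim]
theorem tens_two_induction {n : ℕ} {P : TensorAlgebra k V → Prop}
    (hmul : ∀ (z : V ⊗[k] V), ∀ y ∈ tens k V n, P (glueTwo k V z * y))
    (hadd : ∀ x y, P x → P y → P (x + y)) {x : TensorAlgebra k V} (hx : x ∈ tens k V (n + 2)) :
    P x := by
  refine tens_succ_induction (fun v y hy => ?_) hadd hx
  refine tens_succ_induction (P := fun y => P (TensorAlgebra.ι k v * y)) (fun w z hz => ?_)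
    (fun a b ha hb => by rw [mul_add]; exact hadd _ _ ha hb) hy
  rw [← mul_assoc, ← glueTwo_tmul]
  exact hmul _ _ hz

theorem mem_tens_two {x : TensorAlgebra k V} (hx : x ∈ tens k V 2) :
    ∃ z, x = glueTwo k V z := by
  have hx' : x ∈ tens k V (0 + 2) := hx
  refine tens_two_induction (fun z y hy => ?_) ?_ hx'
  · obtain ⟨c, rfl⟩ := mem_tens_zero hy
    exact ⟨c • z, by simp⟩
  · rintro _ _ ⟨z, rfl⟩ ⟨w, rfl⟩
    exact ⟨z + w, by simp⟩

theorem glue_tmul (v : V) (x : TensorAlgebra k V) :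
    glue k V (v ⊗ₜ x) = TensorAlgebra.ι k v * x := by
  simp [glue]

theorem cut_glue (z : V ⊗[k] TensorAlgebra k V) : cut k V (glue k V z) = z := by
  induction z using TensorProduct.induction_on with
  | zero => simp
  | tmul v w => rw [glue_tmul, cut_ι_mul]
  | add x y hx hy => rw [map_add, map_add, hx, hy]

theorem cut_of_mem_tens_zero {x : TensorAlgebra k V} (hx : x ∈ tens k V 0) : cut k V x = 0 := by
  obtain ⟨c, rfl⟩ := mem_tens_zero hx
  rw [map_smul, cut_one, smul_zero]

/-- Splitting off two factors and reading the remaining scalar is a left inverse. -/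
theorem glueTwo_injective : Function.Injective (glueTwo k V) := by
  have h : Function.LeftInverse
      ((TensorProduct.rid k V).toLinearMap.lTensor V ∘ₗ
        (LinearMap.lTensor V (LinearMap.lTensor V TensorAlgebra.algebraMapInv.toLinearMap)) ∘ₗ
        LinearMap.lTensor V (cut k V) ∘ₗ cut k V) (glueTwo k V) := by
    intro z
    induction z using TensorProduct.induction_on with
    | zero => simp
    | tmul v w =>
      have : cut k V (TensorAlgebra.ι k w) = w ⊗ₜ 1 := by
        simpa using cut_ι_mul w (1 : TensorAlgebra k V)
      rw [glueTwo_tmul]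
      simp [cut_ι_mul, this]
    | add x y hx hy => rw [map_add, map_add, hx, hy]
  exact h.injective

/-! ### Operators beyond the first factor, and contraction of the first factor -/

/-- `Id ⊗ X` on `V ⊗ T(V)`, as an operator on `T(V)`. -/
def shift (X : Module.End k (TensorAlgebra k V)) : Module.End k (TensorAlgebra k V) :=
  glue k V ∘ₗ LinearMap.lTensor V X ∘ₗ cut k V

theorem shift_ι_mul (X : Module.End k (TensorAlgebra k V)) (v : V) (x : TensorAlgebra k V) :
    shift X (TensorAlgebra.ι k v * x) = TensorAlgebra.ι k v * X x := by
  simp [shift, cut_ι_mul, glue_tmul]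

theorem shift_of_mem_tens_zero (X : Module.End k (TensorAlgebra k V)) {x : TensorAlgebra k V}
    (hx : x ∈ tens k V 0) : shift X x = 0 := by
  simp [shift, cut_of_mem_tens_zero hx]

theorem shift_mul (X Y : Module.End k (TensorAlgebra k V)) :
    shift (X * Y) = shift X * shift Y := by
  ext1 x
  simp only [shift, LinearMap.comp_apply, cut_glue, Module.End.mul_eq_comp,
    LinearMap.lTensor_comp]

theorem shift_add (X Y : Module.End k (TensorAlgebra k V)) :
    shift (X + Y) = shift X + shift Y := by
  ext1 x
  simp [shift, LinearMap.lTensor_add]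

theorem shift_smul (c : k) (X : Module.End k (TensorAlgebra k V)) :
    shift (c • X) = c • shift X := by
  ext1 x
  simp [shift, LinearMap.lTensor_smul]

/-- Positive degree is essential: `shift` annihilates degree 0, so `shift 1` is not the identity
there. -/
theorem shift_one_apply {n : ℕ} {x : TensorAlgebra k V} (hx : x ∈ tens k V (n + 1)) :
    shift 1 x = x := by
  refine tens_succ_induction (fun v y hy => ?_) (fun x y hx hy => ?_) hx
  · rw [shift_ι_mul, Module.End.one_apply]
  · rw [map_add, hx, hy]

theorem shift_mul_mem_tens {X : Module.End k (TensorAlgebra k V)}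
    (hX : ∀ n, ∀ x ∈ tens k V n, X x ∈ tens k V n) (n : ℕ) {x : TensorAlgebra k V}
    (hx : x ∈ tens k V n) : shift X x ∈ tens k V n := by
  cases n with
  | zero => rw [shift_of_mem_tens_zero X hx]; exact zero_mem _
  | succ n =>
    refine tens_succ_induction (fun v y hy => ?_) (fun x y hx hy => ?_) hx
    · rw [shift_ι_mul]; exact ι_mul_mem_tens v (hX _ _ hy)
    · rw [map_add]; exact add_mem hx hy

/-- Contraction of the first tensor factor with a linear function. -/
def contr (ξ : Module.Dual k V) : Module.End k (TensorAlgebra k V) :=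
  (TensorProduct.lid k (TensorAlgebra k V)).toLinearMap ∘ₗ
    LinearMap.rTensor (TensorAlgebra k V) ξ ∘ₗ cut k V

theorem contr_ι_mul (ξ : Module.Dual k V) (v : V) (x : TensorAlgebra k V) :
    contr ξ (TensorAlgebra.ι k v * x) = ξ v • x := by
  simp [contr, cut_ι_mul]

/-- `shift X` does not touch the factor being contracted. It holds in every degree, since both sides
vanish on scalars. -/
theorem contr_shift (ξ : Module.Dual k V) (X : Module.End k (TensorAlgebra k V))
    (x : TensorAlgebra k V) : contr ξ (shift X x) = X (contr ξ x) := by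
  simp only [contr, shift, LinearMap.comp_apply, cut_glue]
  generalize cut k V x = z
  induction z using TensorProduct.induction_on with
  | zero => simp
  | tmul v w => simp
  | add x y hx hy => simp only [map_add, hx, hy]

theorem contr_mem_tens (ξ : Module.Dual k V) {n : ℕ} {x : TensorAlgebra k V}
    (hx : x ∈ tens k V (n + 1)) : contr ξ x ∈ tens k V n := by
  refine tens_succ_induction (fun v y hy => ?_) (fun x y hx hy => ?_) hx
  · rw [contr_ι_mul]; exact Submodule.smul_mem _ _ hy
  · rw [map_add]; exact add_mem hx hy

theorem contr_mul (ξ : Module.Dual k V) {n : ℕ} {x : TensorAlgebra k V}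
    (hx : x ∈ tens k V (n + 1)) (w : TensorAlgebra k V) :
    contr ξ (x * w) = contr ξ x * w := by
  refine tens_succ_induction (fun v y hy => ?_) (fun x y hx hy => ?_) hx
  · rw [mul_assoc, contr_ι_mul, contr_ι_mul, smul_mul_assoc]
  · rw [add_mul, map_add, map_add, hx, hy, add_mul]

theorem sum_ι_mul_contr {ι : Type*} [Fintype ι] (e : Module.Basis ι k V) {n : ℕ}
    {x : TensorAlgebra k V} (hx : x ∈ tens k V (n + 1)) :
    ∑ s, TensorAlgebra.ι k (e s) * contr (e.coord s) x = x := by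
  refine tens_succ_induction (fun v y hy => ?_) (fun x y hx hy => ?_) hx
  · have h : TensorAlgebra.ι k v = ∑ s, e.repr v s • TensorAlgebra.ι k (e s) := by
      conv_lhs => rw [← e.sum_repr v, map_sum]
      simp only [map_smul]
    simp only [contr_ι_mul, Module.Basis.coord_apply]
    rw [h, Finset.sum_mul]
    simp
  · conv_rhs => rw [← hx, ← hy]
    simp [mul_add, Finset.sum_add_distrib]

/-- A tensor of positive degree is rebuilt from its contractions with a dual basis. This is the
induction device of the whole proof: identities in degree n + 1 are tested in degree n. -/
theorem eq_of_contr_eq [FiniteDimensional k V] {n : ℕ} {x y : TensorAlgebra k V}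
    (hx : x ∈ tens k V (n + 1)) (hy : y ∈ tens k V (n + 1))
    (h : ∀ ξ : Module.Dual k V, contr ξ x = contr ξ y) : x = y := by
  rw [← sum_ι_mul_contr (Module.finBasis k V) hx, ← sum_ι_mul_contr (Module.finBasis k V) hy]
  simp only [h]

/-! ### The braid and Hecke relations -/

section act

variable (R : V ⊗[k] V →ₗ[k] V ⊗[k] V)

theorem act_succ (i : ℕ) : act R (i + 1) = shift (act R i) := rfl

theorem act_zero_glueTwo_mul (z : V ⊗[k] V) (b : TensorAlgebra k V) :
    act R 0 (glueTwo k V z * b) = glueTwo k V (R z) * b := by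
  simpa using act_apply R 0 one_mem_tens z b

/-- Because of this default value the commutation and braid relations hold on all of T(V), both
sides being 0 in low degree. The quadratic Hecke relation fails there and needs a degree bound. -/
theorem act_of_lt (i : ℕ) {n : ℕ} (h : n < i + 2) {x : TensorAlgebra k V} (hx : x ∈ tens k V n) :
    act R i x = 0 := by
  induction i generalizing n x with
  | zero =>
    obtain _ | _ | n := n
    · simp [act, cut_of_mem_tens_zero hx]
    · refine tens_succ_induction (fun v y hy => ?_) (fun x y hx hy => ?_) hx
      · simp [act, cut_ι_mul, cut_of_mem_tens_zero hy]
      · rw [map_add, hx, hy, add_zero]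
    · omega
  | succ i ih =>
    cases n with
    | zero => rw [act_succ, shift_of_mem_tens_zero _ hx]
    | succ n =>
      refine tens_succ_induction (fun v y hy => ?_) (fun x y hx hy => ?_) hx
      · rw [act_succ, shift_ι_mul, ih (by omega) hy, mul_zero]
      · rw [map_add, hx, hy, add_zero]

theorem act_mem_tens (i n : ℕ) {x : TensorAlgebra k V} (hx : x ∈ tens k V n) :
    act R i x ∈ tens k V n := by
  induction i generalizing n x with
  | zero =>
    obtain h | ⟨m, rfl⟩ : n < 2 ∨ ∃ m, n = m + 2 := by
      by_cases h : n < 2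
      · exact Or.inl h
      · exact Or.inr ⟨n - 2, by omega⟩
    · rw [act_of_lt R 0 h hx]; exact zero_mem _
    · refine tens_two_induction (fun z y hy => ?_) (fun x y hx hy => ?_) hx
      · rw [act_zero_glueTwo_mul]; exact mul_mem_tens (add_comm 2 m) (glueTwo_mem_tens _) hy
      · rw [map_add]; exact add_mem hx hy
  | succ i ih => rw [act_succ]; exact shift_mul_mem_tens (fun n x hx => ih n hx) n hx

theorem act_add_mul (d i : ℕ) {a : TensorAlgebra k V} (ha : a ∈ tens k V d)
    (x : TensorAlgebra k V) : act R (i + d) (a * x) = a * act R i x := by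
  induction d generalizing a x with
  | zero => obtain ⟨c, rfl⟩ := mem_tens_zero ha; simp
  | succ d ih =>
    refine tens_succ_induction (fun v y hy => ?_) (fun x y hx hy => ?_) ha
    · rw [← add_assoc, act_succ, mul_assoc, shift_ι_mul, ih hy, mul_assoc]
    · rw [add_mul, map_add, hx, hy, add_mul]

theorem act_mul {i m : ℕ} (h : i + 2 ≤ m) {u : TensorAlgebra k V} (hu : u ∈ tens k V m)
    (w : TensorAlgebra k V) : act R i (u * w) = act R i u * w := by
  induction i generalizing m u with
  | zero =>
    obtain ⟨m, rfl⟩ := Nat.exists_eq_add_of_le' h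
    refine tens_two_induction (fun z y hy => ?_) (fun x y hx hy => ?_) hu
    · rw [mul_assoc, act_zero_glueTwo_mul, act_zero_glueTwo_mul, mul_assoc]
    · rw [add_mul, map_add, hx, hy, map_add, add_mul]
  | succ i ih =>
    obtain ⟨m, rfl⟩ := Nat.exists_eq_add_of_le' (show 1 ≤ m by omega)
    refine tens_succ_induction (fun v y hy => ?_) (fun x y hx hy => ?_) hu
    · rw [act_succ, mul_assoc, shift_ι_mul, shift_ι_mul, ih (by omega) hy, mul_assoc]
    · rw [add_mul, map_add, hx, hy, map_add, add_mul]

/-- The two operators act on disjoint sets of tensor factors. The form with arbitrary X also serves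
later for partial antisymmetrizers. -/
theorem act_zero_mul_shift_shift (X : Module.End k (TensorAlgebra k V)) :
    act R 0 * shift (shift X) = shift (shift X) * act R 0 := by
  refine linearMap_ext_tens fun n x hx => ?_
  simp only [Module.End.mul_apply]
  obtain _ | _ | n := n
  · simp [shift_of_mem_tens_zero _ hx, act_of_lt R 0 _ hx]
  · refine tens_succ_induction (fun v y hy => ?_) (fun x y hx hy => ?_) hx
    · rw [shift_ι_mul, shift_of_mem_tens_zero _ hy,
        act_of_lt R 0 (by omega) (ι_mul_mem_tens v hy)]
      simp
    · simp only [map_add, hx, hy]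
  · have key : ∀ (z : V ⊗[k] V) (y : TensorAlgebra k V),
        shift (shift X) (glueTwo k V z * y) = glueTwo k V z * X y := by
      intro z y
      induction z using TensorProduct.induction_on with
      | zero => simp
      | tmul v w => rw [glueTwo_tmul, mul_assoc, shift_ι_mul, shift_ι_mul, mul_assoc]
      | add x y hx hy => simp only [map_add, add_mul, hx, hy]
    refine tens_two_induction (fun z y hy => ?_) (fun x y hx hy => ?_) hx
    · rw [key, act_zero_glueTwo_mul, act_zero_glueTwo_mul, key]
    · simp only [map_add, hx, hy]

theorem act_comm {i j : ℕ} (h : i + 2 ≤ j) : act R i * act R j = act R j * act R i := by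
  induction i generalizing j with
  | zero =>
    obtain ⟨j, rfl⟩ := Nat.exists_eq_add_of_le' h
    exact act_zero_mul_shift_shift R (act R j)
  | succ i ih =>
    obtain ⟨j, rfl⟩ := Nat.exists_eq_add_of_le' (show 1 ≤ j by omega)
    rw [act_succ, act_succ, ← shift_mul, ih (by omega), shift_mul]

variable {R}
variable {q : k}

theorem act_braid (hR : IsHeckeSymmetry R q) (i : ℕ) :
    act R i * act R (i + 1) * act R i = act R (i + 1) * act R i * act R (i + 1) := by
  induction i with
  | succ i ih => simp only [act_succ, ← shift_mul] at ih ⊢; rw [ih]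
  | zero =>
    let R₁ : Module.End k (V ⊗[k] V ⊗[k] V) := LinearMap.rTensor V R
    let R₂ : Module.End k (V ⊗[k] V ⊗[k] V) :=
      (TensorProduct.assoc k V V V).symm.toLinearMap ∘ₗ LinearMap.lTensor V R ∘ₗ
        (TensorProduct.assoc k V V V).toLinearMap
    have hb : ∀ z, R₁ (R₂ (R₁ z)) = R₂ (R₁ (R₂ z)) := fun z => congrArg (fun g => g z) hR.braid
    -- Multiplication V ⊗ V ⊗ V → T(V) intertwines `R₁`, `R₂` with the actions on the first three
    -- factors, which transports the braid equation.
    let g : V ⊗[k] V ⊗[k] V →ₗ[k] TensorAlgebra k V :=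
      TensorProduct.lift ((LinearMap.mul k (TensorAlgebra k V)).compl₁₂ (glueTwo k V)
        (TensorAlgebra.ι k))
    have h1 : ∀ z y, act R 0 (g z * y) = g (R₁ z) * y := by
      intro z y
      induction z using TensorProduct.induction_on with
      | zero => simp
      | tmul v w => simp [g, R₁, mul_assoc, act_zero_glueTwo_mul]
      | add x y hx hy => simp only [map_add, add_mul, hx, hy]
    have h2 : ∀ z y, act R 1 (g z * y) = g (R₂ z) * y := by
      intro z y
      induction z using TensorProduct.induction_on with
      | zero => simp
      | add x y hx hy => simp only [map_add, add_mul, hx, hy]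
      | tmul a u =>
      induction a using TensorProduct.induction_on with
      | zero => simp
      | add x y hx hy => simp only [map_add, add_mul, TensorProduct.add_tmul, hx, hy]
      | tmul v w =>
      have h3 : ∀ z, g ((TensorProduct.assoc k V V V).symm (v ⊗ₜ z))
          = TensorAlgebra.ι k v * glueTwo k V z := by
        intro z
        induction z using TensorProduct.induction_on with
        | zero => simp
        | add x y hx hy => simp only [map_add, mul_add, TensorProduct.tmul_add, hx, hy]
        | tmul a b => simp [g, glueTwo_tmul, mul_assoc]
      have h4 : g (v ⊗ₜ w ⊗ₜ u) = TensorAlgebra.ι k v * glueTwo k V (w ⊗ₜ u) := by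
        simp [g, glueTwo_tmul, mul_assoc]
      rw [h4, mul_assoc, act_succ, shift_ι_mul, act_zero_glueTwo_mul, ← mul_assoc, ← h3]
      rfl
    refine linearMap_ext_tens fun n x hx => ?_
    simp only [Module.End.mul_apply]
    by_cases hn : n < 3
    · rw [act_of_lt R _ hn (act_mem_tens R 0 n hx), act_of_lt R _ hn hx]; simp
    · obtain ⟨n, rfl⟩ := Nat.exists_eq_add_of_le' (not_lt.mp hn)
      have hx' : x ∈ tens k V ((n + 1) + 2) := hx
      refine tens_two_induction (fun z y hy => ?_) (fun x y hx hy => ?_) hx'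
      · refine tens_succ_induction (fun v y hy => ?_) (fun x y hx hy => ?_) hy
        · have : glueTwo k V z * (TensorAlgebra.ι k v * y) = g (z ⊗ₜ v) * y := by
            simp [g, mul_assoc]
          rw [this]
          simp only [h1, h2, hb, zero_add]
        · simp only [mul_add, map_add, hx, hy]
      · simp only [map_add, hx, hy]

theorem act_hecke (hR : IsHeckeSymmetry R q) {i n : ℕ} (h : i + 2 ≤ n) {x : TensorAlgebra k V}
    (hx : x ∈ tens k V n) : act R i (act R i x) = (q - 1) • act R i x + q • x := by
  induction i generalizing n x with
  | zero =>
    obtain ⟨n, rfl⟩ := Nat.exists_eq_add_of_le' h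
    have hz : ∀ z, R (R z) = (q - 1) • R z + q • z := by
      intro z
      have h3 : R (R z + z) - q • (R z + z) = 0 := congrArg (fun g => g z) hR.hecke
      rw [map_add, smul_add, sub_eq_zero] at h3
      rw [sub_smul, one_smul, sub_add_eq_add_sub, ← h3]
      abel
    refine tens_two_induction (fun z y hy => ?_) (fun x y hx hy => ?_) hx
    · rw [act_zero_glueTwo_mul, act_zero_glueTwo_mul, hz]
      simp [add_mul]
    · simp only [map_add, hx, hy, smul_add]; abel
  | succ i ih =>
    obtain ⟨n, rfl⟩ := Nat.exists_eq_add_of_le' (show 1 ≤ n by omega)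
    refine tens_succ_induction (fun v y hy => ?_) (fun x y hx hy => ?_) hx
    · rw [act_succ, shift_ι_mul, shift_ι_mul, ih (by omega) hy]
      simp [mul_add]
    · simp only [map_add, hx, hy, smul_add]; abel

end act

end

section

/-! ### Permutations and the operators `T_σ` -/

theorem adj_val {n i : ℕ} (h : i + 1 < n) (x : Fin n) :
    (adj i h x : ℕ) = if (x : ℕ) = i then i + 1 else if (x : ℕ) = i + 1 then i else x := by
  simp only [adj, Equiv.swap_apply_def, Fin.ext_iff]
  split_ifs <;> rfl

theorem adj_mul_self {n i : ℕ} (h : i + 1 < n) : adj i h * adj i h = 1 :=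
  Equiv.swap_mul_self _ _

theorem adj_comm {n i j : ℕ} (hi : i + 1 < n) (hj : j + 1 < n) (h : i + 2 ≤ j) :
    adj i hi * adj j hj = adj j hj * adj i hi := by
  ext x
  simp only [Equiv.Perm.mul_apply, adj_val]
  split_ifs <;> omega

theorem adj_braid {n i : ℕ} (hi : i + 1 < n) (hj : i + 1 + 1 < n) :
    adj i hi * adj (i + 1) hj * adj i hi = adj (i + 1) hj * adj i hi * adj (i + 1) hj := by
  ext x
  simp only [Equiv.Perm.mul_apply, adj_val]
  split_ifs <;> omega

theorem len_mul_adj {n i : ℕ} {σ : Equiv.Perm (Fin n)} (h : i + 1 < n) (hd : IsDescent σ i) :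
    len (σ * adj i h) + 1 = len σ := by
  obtain ⟨_, hd⟩ := hd
  set a : Fin n := ⟨i, Nat.lt_of_succ_lt h⟩ with ha
  set b : Fin n := ⟨i + 1, h⟩ with hb
  have hab : a < b := by simp [ha, hb, Fin.lt_def]
  have hadj : adj i h = Equiv.swap a b := rfl
  rw [hadj]
  have key : ∀ x y : Fin n, x < y → ¬ (x = a ∧ y = b) →
      Equiv.swap a b x < Equiv.swap a b y := by
    intro x y hxy hne
    have hav : (a : ℕ) = i := rfl
    have hbv : (b : ℕ) = i + 1 := rfl
    simp only [Equiv.swap_apply_def]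
    simp only [Fin.lt_def, Fin.ext_iff] at *
    split_ifs <;> omega
  -- Right multiplication by τ_i removes the inversion (i, i+1) and permutes the others, since τ_i
  -- keeps the order of every other pair.
  have hset : (Finset.univ.filter fun p : Fin n × Fin n => p.1 < p.2 ∧ σ p.2 < σ p.1) =
      insert (a, b) ((Finset.univ.filter fun p : Fin n × Fin n => p.1 < p.2 ∧
        (σ * Equiv.swap a b) p.2 < (σ * Equiv.swap a b) p.1).map
          ((Equiv.swap a b).prodCongr (Equiv.swap a b)).toEmbedding) := by
    ext ⟨x, y⟩
    rw [Finset.mem_insert, Finset.mem_map_equiv, Finset.mem_filter, Finset.mem_filter]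
    simp only [Finset.mem_univ, true_and, Equiv.prodCongr_symm, Equiv.symm_swap,
      Equiv.prodCongr_apply, Prod.map_apply, Equiv.Perm.mul_apply, Equiv.swap_apply_self,
      Prod.mk.injEq]
    constructor
    · rintro ⟨h1, h2⟩
      by_cases hne : x = a ∧ y = b
      · exact Or.inl hne
      · exact Or.inr ⟨key x y h1 hne, h2⟩
    · rintro (⟨rfl, rfl⟩ | ⟨h1, h2⟩)
      · exact ⟨hab, hd⟩
      · refine ⟨?_, h2⟩
        have := key _ _ h1 ?_
        · simpa using this
        · rintro ⟨h3, h4⟩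
          have hx : x = b := by
            simpa using congrArg (Equiv.swap a b) h3
          have hy : y = a := by
            simpa using congrArg (Equiv.swap a b) h4
          subst hx hy
          exact absurd h2 (not_lt.mpr hd.le)
  unfold len
  rw [hset, Finset.card_insert_of_notMem, Finset.card_map]
  rw [Finset.mem_map_equiv, Finset.mem_filter]
  simp only [Finset.mem_univ, true_and, Equiv.prodCongr_symm, Equiv.symm_swap,
    Equiv.prodCongr_apply, Prod.map_apply, Equiv.swap_apply_left, Equiv.swap_apply_right, not_and]
  exact fun h => absurd h (not_lt.mpr hab.le)

section heckeOp


variable (R : V ⊗[k] V →ₗ[k] V ⊗[k] V)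

theorem isDescent_mul_adj_iff {n i j : ℕ} (σ : Equiv.Perm (Fin n)) (hi : i + 1 < n)
    (hj : j + 1 < n) : IsDescent (σ * adj i hi) j ↔
      σ (adj i hi ⟨j + 1, hj⟩) < σ (adj i hi ⟨j, Nat.lt_of_succ_lt hj⟩) :=
  ⟨fun h => h.choose_spec, fun h => ⟨hj, h⟩⟩

theorem heckeOp_of_not_descent {n : ℕ} {σ : Equiv.Perm (Fin n)} (h : ∀ i, ¬ IsDescent σ i) :
    heckeOp R σ = 1 := by
  rw [heckeOp, dif_neg]
  rintro ⟨i, hi⟩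
  exact h i hi

variable {R} {q : k}

/-- This is the local confluence behind Matsumoto's theorem. Two distant descents can be removed in
either order by commutation. Two neighbouring descents mean that σ ends in the longest element of a
copy of S_3, and both reductions continue to the same permutation through the braid relation. -/
theorem heckeOp_mul_act_eq (hR : IsHeckeSymmetry R q) {n : ℕ} (σ : Equiv.Perm (Fin n))
    (ih : ∀ τ : Equiv.Perm (Fin n), len τ < len σ → ∀ (i : ℕ) (hi : i + 1 < n), IsDescent τ i →
      heckeOp R τ = heckeOp R (τ * adj i hi) * act R i)
    {i j : ℕ} (hi : i + 1 < n) (hj : j + 1 < n) (hij : i < j)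
    (hdi : IsDescent σ i) (hdj : IsDescent σ j) :
    heckeOp R (σ * adj i hi) * act R i = heckeOp R (σ * adj j hj) * act R j := by
  have hli := len_mul_adj hi hdi
  have hlj := len_mul_adj hj hdj
  obtain ⟨_, h1⟩ := hdi
  obtain ⟨_, h2⟩ := hdj
  obtain h | rfl : i + 2 ≤ j ∨ j = i + 1 := by omega
  · rw [ih (σ * adj i hi) (by omega) j hj, ih (σ * adj j hj) (by omega) i hi,
      mul_assoc, mul_assoc, mul_assoc, mul_assoc, adj_comm hi hj h, act_comm R h]
    · rw [isDescent_mul_adj_iff _ _ hi]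
      have e1 : adj j hj ⟨i + 1, hi⟩ = ⟨i + 1, hi⟩ := by
        ext; rw [adj_val]; simp only; split_ifs <;> omega
      have e2 : adj j hj ⟨i, Nat.lt_of_succ_lt hi⟩ = ⟨i, Nat.lt_of_succ_lt hi⟩ := by
        ext; rw [adj_val]; simp only; split_ifs <;> omega
      rw [e1, e2]; exact h1
    · rw [isDescent_mul_adj_iff _ _ hj]
      have e1 : adj i hi ⟨j + 1, hj⟩ = ⟨j + 1, hj⟩ := by
        ext; rw [adj_val]; simp only; split_ifs <;> omega
      have e2 : adj i hi ⟨j, Nat.lt_of_succ_lt hj⟩ = ⟨j, Nat.lt_of_succ_lt hj⟩ := by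
        ext; rw [adj_val]; simp only; split_ifs <;> omega
      rw [e1, e2]; exact h2
  · have hi' : i < n := by omega
    have a1 : adj i hi ⟨i, hi'⟩ = ⟨i + 1, hi⟩ := by ext; simp [adj_val]
    have a2 : adj i hi ⟨i + 1, hi⟩ = ⟨i, hi'⟩ := by ext; simp [adj_val]
    have a3 : adj i hi ⟨i + 1 + 1, hj⟩ = ⟨i + 1 + 1, hj⟩ := by
      ext; rw [adj_val]; simp only; split_ifs <;> omega
    have b1 : adj (i + 1) hj ⟨i + 1, hi⟩ = ⟨i + 1 + 1, hj⟩ := by ext; simp [adj_val]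
    have b2 : adj (i + 1) hj ⟨i + 1 + 1, hj⟩ = ⟨i + 1, hi⟩ := by ext; simp [adj_val]
    have b3 : adj (i + 1) hj ⟨i, hi'⟩ = ⟨i, hi'⟩ := by
      ext; rw [adj_val]; simp only; split_ifs <;> omega
    have d1 : IsDescent (σ * adj i hi) (i + 1) := by
      rw [isDescent_mul_adj_iff _ _ hj, a2, a3]; exact h2.trans h1
    have d2 : IsDescent (σ * adj i hi * adj (i + 1) hj) i := by
      rw [isDescent_mul_adj_iff _ _ hi, b1, b3, Equiv.Perm.mul_apply, Equiv.Perm.mul_apply, a1, a3]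
      exact h2
    have d3 : IsDescent (σ * adj (i + 1) hj) i := by
      rw [isDescent_mul_adj_iff _ _ hi, b1, b3]; exact h2.trans h1
    have d4 : IsDescent (σ * adj (i + 1) hj * adj i hi) (i + 1) := by
      rw [isDescent_mul_adj_iff _ _ hj, a2, a3, Equiv.Perm.mul_apply, Equiv.Perm.mul_apply, b3, b2]
      exact h1
    have l1 := len_mul_adj hj d1
    have l3 := len_mul_adj hi d3
    rw [ih _ (by omega) _ hj d1, ih _ (by omega) _ hi d2, ih _ (by omega) _ hi d3,
      ih _ (by omega) _ hj d4]
    have e1 : σ * adj i hi * adj (i + 1) hj * adj i hi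
        = σ * adj (i + 1) hj * adj i hi * adj (i + 1) hj := by
      have := congrArg (σ * ·) (adj_braid hi hj)
      simpa only [mul_assoc] using this
    rw [e1]
    have := congrArg (heckeOp R (σ * adj (i + 1) hj * adj i hi * adj (i + 1) hj) * ·)
      (act_braid hR i)
    simpa only [mul_assoc] using this

/-- Every descent of `σ` yields the recursion `T_σ = T_{σ τ_i} T_i`. -/
theorem heckeOp_eq (hR : IsHeckeSymmetry R q) {n : ℕ} (σ : Equiv.Perm (Fin n)) {i : ℕ}
    (hi : i + 1 < n) (hd : IsDescent σ i) :
    heckeOp R σ = heckeOp R (σ * adj i hi) * act R i := by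
  induction hl : len σ using Nat.strong_induction_on generalizing σ i with
  | _ l ih =>
    have hex : ∃ i, IsDescent σ i := ⟨i, hd⟩
    have ih' : ∀ τ : Equiv.Perm (Fin n), len τ < len σ → ∀ (i : ℕ) (hi : i + 1 < n),
        IsDescent τ i → heckeOp R τ = heckeOp R (τ * adj i hi) * act R i :=
      fun τ hτ i hi h => ih (len τ) (hl ▸ hτ) τ hi h rfl
    rw [heckeOp, dif_pos hex]
    suffices h : ∀ (j : ℕ) (hj : j + 1 < n), IsDescent σ j →
        heckeOp R (σ * adj j hj) * act R j = heckeOp R (σ * adj i hi) * act R i from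
      h _ _ hex.choose_spec
    intro j hj hdj
    rcases lt_trichotomy i j with h | rfl | h
    · exact (heckeOp_mul_act_eq hR σ ih' hi hj h hd hdj).symm
    · rfl
    · exact heckeOp_mul_act_eq hR σ ih' hj hi h hdj hd

/-! ### Splitting a permutation by the position of the value 0 -/

/-- The permutation of `{0, …, m}` fixing `0` and acting as `σ` on the remaining elements. -/
def extend {m : ℕ} (σ : Equiv.Perm (Fin m)) : Equiv.Perm (Fin (m + 1)) :=
  Equiv.Perm.decomposeFin.symm (0, σ)

theorem extend_zero {m : ℕ} (σ : Equiv.Perm (Fin m)) : extend σ 0 = 0 := by simp [extend]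

theorem extend_succ {m : ℕ} (σ : Equiv.Perm (Fin m)) (x : Fin m) :
    extend σ x.succ = (σ x).succ := by simp [extend]

theorem extend_injective {m : ℕ} : Function.Injective (extend (m := m)) := fun σ τ h => by
  simpa [extend] using h

theorem len_extend {m : ℕ} (σ : Equiv.Perm (Fin m)) : len (extend σ) = len σ := by
  unfold len
  rw [← Finset.card_map ((Fin.succEmb m).prodMap (Fin.succEmb m))]
  congr 1
  ext ⟨x, y⟩
  simp only [Finset.mem_map, Finset.mem_filter, Finset.mem_univ, true_and]
  constructor
  · rintro ⟨h1, h2⟩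
    induction y using Fin.cases with
    | zero => simp at h1
    | succ y =>
    induction x using Fin.cases with
    | zero => simp [extend_zero] at h2
    | succ x => exact ⟨(x, y), ⟨Fin.succ_lt_succ_iff.mp h1, by simpa [extend_succ] using h2⟩, rfl⟩
  · rintro ⟨⟨x, y⟩, ⟨h1, h2⟩, h⟩
    obtain ⟨rfl, rfl⟩ := Prod.mk.inj h
    exact ⟨Fin.succ_lt_succ_iff.mpr h1, by
      change extend σ y.succ < extend σ x.succ
      simpa [extend_succ] using h2⟩

theorem isDescent_extend_succ {m : ℕ} (σ : Equiv.Perm (Fin m)) (i : ℕ) :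
    IsDescent (extend σ) (i + 1) ↔ IsDescent σ i := by
  constructor
  · rintro ⟨h, hd⟩
    refine ⟨by omega, ?_⟩
    rw [← Fin.succ_lt_succ_iff, ← extend_succ, ← extend_succ]
    exact hd
  · rintro ⟨h, hd⟩
    refine ⟨by omega, ?_⟩
    rw [← Fin.succ_lt_succ_iff, ← extend_succ, ← extend_succ] at hd
    exact hd

theorem not_isDescent_extend_zero {m : ℕ} (σ : Equiv.Perm (Fin m)) :
    ¬ IsDescent (extend σ) 0 := by
  rintro ⟨h, hd⟩
  have : (⟨0, Nat.lt_of_succ_lt h⟩ : Fin (m + 1)) = 0 := rfl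
  rw [this, extend_zero] at hd
  exact absurd hd (by simp)

theorem extend_mul_adj {m i : ℕ} (σ : Equiv.Perm (Fin m)) (h : i + 1 < m) :
    extend (σ * adj i h) = extend σ * adj (i + 1) (by omega) := by
  have key : ∀ x : Fin m, adj (i + 1) (by omega) x.succ = (adj i h x).succ := by
    intro x
    ext
    simp only [adj_val, Fin.val_succ]
    split_ifs <;> omega
  ext1 x
  induction x using Fin.cases with
  | zero =>
    have : adj (i + 1) (by omega) (0 : Fin (m + 1)) = 0 := by
      ext
      simp [adj_val]
    rw [Equiv.Perm.mul_apply, this, extend_zero, extend_zero]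
  | succ x => rw [Equiv.Perm.mul_apply, key, extend_succ, extend_succ, Equiv.Perm.mul_apply]

/-- The descents of 1 × σ are those of σ moved by one, so a reduced word of 1 × σ avoids T_0 and
acts as Id ⊗ T_σ. Phrasing it after contraction keeps it true in degree 0, where `shift 1` is not
the identity. -/
theorem contr_heckeOp_extend (hR : IsHeckeSymmetry R q) {m : ℕ} (σ : Equiv.Perm (Fin m))
    (ξ : Module.Dual k V) (x : TensorAlgebra k V) :
    contr ξ (heckeOp R (extend σ) x) = heckeOp R σ (contr ξ x) := by
  induction hl : len σ using Nat.strong_induction_on generalizing σ x with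
  | _ l ih =>
    by_cases h : ∃ i, IsDescent σ i
    · obtain ⟨i, hd⟩ := h
      obtain ⟨hi, _⟩ := id hd
      have hlen := len_mul_adj hi hd
      rw [heckeOp_eq hR _ hi hd, heckeOp_eq hR (extend σ) (by omega : i + 1 + 1 < m + 1)
        ((isDescent_extend_succ σ i).mpr hd), ← extend_mul_adj σ hi, Module.End.mul_apply,
        ih (len (σ * adj i hi)) (by omega) _ _ rfl, act_succ, contr_shift, Module.End.mul_apply]
    · have h' : ∀ i, ¬ IsDescent (extend σ) i := by
        rintro (_ | i) hd
        · exact not_isDescent_extend_zero σ hd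
        · exact h ⟨i, (isDescent_extend_succ σ i).mp hd⟩
      rw [heckeOp_of_not_descent R h', heckeOp_of_not_descent R (fun i hi => h ⟨i, hi⟩)]
      rfl

variable (R) in
/-- The operator `T_0 T_1 ⋯ T_{p-1}`, which moves the tensor factor at position `p` to the
front. -/
def moveOp : ℕ → Module.End k (TensorAlgebra k V)
  | 0 => 1
  | p + 1 => moveOp p * act R p

theorem cycleRange_val {m : ℕ} (p x : Fin (m + 1)) :
    (Fin.cycleRange p x : ℕ) = if (x : ℕ) < p then (x : ℕ) + 1 else if (x : ℕ) = p then 0 else x := by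
  rcases lt_trichotomy x p with h | rfl | h
  · rw [Fin.coe_cycleRange_of_lt h, if_pos (Fin.lt_def.mp h)]
  · simp
  · rw [Fin.cycleRange_of_gt h]
    have := Fin.lt_def.mp h
    split_ifs <;> omega

theorem cycleRange_succ {m p : ℕ} (h : p + 1 < m + 1) :
    Fin.cycleRange (⟨p + 1, h⟩ : Fin (m + 1)) = Fin.cycleRange ⟨p, by omega⟩ * adj p h := by
  ext x
  simp only [Equiv.Perm.mul_apply, cycleRange_val, adj_val]
  split_ifs <;> omega

theorem cycleRange_mul_isDescent {m p : ℕ} (σ : Equiv.Perm (Fin m)) (h : p + 1 < m + 1) :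
    IsDescent (extend σ * Fin.cycleRange (⟨p + 1, h⟩ : Fin (m + 1))) p := by
  refine ⟨h, ?_⟩
  rw [Equiv.Perm.mul_apply, Equiv.Perm.mul_apply, Fin.cycleRange_self, extend_zero, Fin.pos_iff_ne_zero]
  intro h0
  rw [← extend_zero σ] at h0
  have h1 := (extend σ).injective h0
  have h2 := Fin.coe_cycleRange_of_lt (i := (⟨p, by omega⟩ : Fin (m + 1))) (j := ⟨p + 1, h⟩)
    (by simp [Fin.lt_def])
  rw [h1] at h2
  simp at h2

/-- Each further transposition moves the value 0 one place to the right and creates one new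
inversion. Hence the factorization is length additive and T is multiplicative on it. -/
theorem len_extend_mul_cycleRange {m p : ℕ} (σ : Equiv.Perm (Fin m)) (h : p < m + 1) :
    len (extend σ * Fin.cycleRange ⟨p, h⟩) = len σ + p := by
  induction p with
  | zero =>
    have : (⟨0, h⟩ : Fin (m + 1)) = 0 := rfl
    rw [this, Fin.cycleRange_zero, mul_one, len_extend, add_zero]
  | succ p ih =>
    rw [← len_mul_adj h (cycleRange_mul_isDescent σ h), cycleRange_succ h, mul_assoc, mul_assoc,
      adj_mul_self, mul_one, ih (by omega), add_assoc]

theorem heckeOp_extend_mul_cycleRange (hR : IsHeckeSymmetry R q) {m p : ℕ}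
    (σ : Equiv.Perm (Fin m)) (h : p < m + 1) :
    heckeOp R (extend σ * Fin.cycleRange ⟨p, h⟩) = heckeOp R (extend σ) * moveOp R p := by
  induction p with
  | zero =>
    have : (⟨0, h⟩ : Fin (m + 1)) = 0 := rfl
    rw [this, Fin.cycleRange_zero, mul_one, moveOp, mul_one]
  | succ p ih =>
    rw [heckeOp_eq hR _ h (cycleRange_mul_isDescent σ h), cycleRange_succ h, mul_assoc, mul_assoc,
      adj_mul_self, mul_one, ih (by omega), moveOp, mul_assoc]

/-- Every permutation of `{0, …, m}` is uniquely `(1 × σ) (0 1 … p)`. -/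
def permSuccEquiv (m : ℕ) : Fin (m + 1) × Equiv.Perm (Fin m) ≃ Equiv.Perm (Fin (m + 1)) :=
  Equiv.ofBijective (fun x => extend x.2 * Fin.cycleRange x.1) <| by
    rw [Fintype.bijective_iff_injective_and_card]
    constructor
    · rintro ⟨p, σ⟩ ⟨r, τ⟩ h
      simp only at h
      -- The number p is recovered as the position at which the permutation takes the value 0.
      have hp : p = r := by
        have h1 : (extend σ * p.cycleRange) p = (extend τ * r.cycleRange) r := by
          simp [extend_zero]
        rw [h] at h1
        exact (extend τ * r.cycleRange).injective h1
      subst hp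
      rw [extend_injective (mul_right_cancel h)]
    · simp [Fintype.card_perm, Nat.factorial_succ]

theorem sum_perm_succ {m : ℕ} {M : Type*} [AddCommMonoid M]
    (g : Equiv.Perm (Fin (m + 1)) → M) :
    ∑ σ, g σ = ∑ p : Fin (m + 1), ∑ σ : Equiv.Perm (Fin m), g (extend σ * Fin.cycleRange p) := by
  rw [← Fintype.sum_prod_type', ← Equiv.sum_comp (permSuccEquiv m)]
  rfl

/-- Guarantees that the subtraction in the exponent of q in y_m is never truncated. -/
theorem len_le {m : ℕ} (σ : Equiv.Perm (Fin m)) : len σ ≤ m * (m - 1) / 2 := by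
  induction m with
  | zero => simp [len]
  | succ m ih =>
    obtain ⟨⟨⟨p, hp⟩, τ⟩, rfl⟩ := (permSuccEquiv m).surjective σ
    have h1 := ih τ
    have h2 := len_extend_mul_cycleRange τ hp
    change len (extend τ * Fin.cycleRange ⟨p, hp⟩) ≤ _
    have h3 := Finset.sum_range_id_mul_two m
    have h4 := Finset.sum_range_id_mul_two (m + 1)
    rw [Finset.sum_range_succ] at h4
    omega

/-! ### Shuffles -/

/-- `σ` is increasing on the first `a` positions and on the remaining ones. -/
def IsSplitMono {n : ℕ} (a : ℕ) (σ : Equiv.Perm (Fin n)) : Prop :=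
  ∀ i j : Fin n, i < j → ((j : ℕ) < a ∨ a ≤ (i : ℕ)) → σ i < σ j

/-- An inversion must pair a position of the first block with one of the second. Again this keeps
the exponent of q from being truncated. -/
theorem len_le_of_isSplitMono {n a : ℕ} {σ : Equiv.Perm (Fin n)} (h : IsSplitMono a σ) :
    len σ ≤ a * (n - a) := by
  have h1 : len σ ≤ ((Finset.univ.filter fun i : Fin n => (i : ℕ) < a) ×ˢ
      (Finset.univ.filter fun i : Fin n => a ≤ (i : ℕ))).card := by
    refine Finset.card_le_card ?_
    rintro ⟨x, y⟩ hxy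
    simp only [Finset.mem_filter, Finset.mem_univ, true_and, Finset.mem_product] at hxy ⊢
    have := mt (h x y hxy.1) (not_lt.mpr hxy.2.le)
    omega
  have h2 := Finset.card_filter_add_card_filter_not (s := (Finset.univ : Finset (Fin n)))
    (fun i : Fin n => (i : ℕ) < a)
  simp only [not_lt, Finset.card_univ, Fintype.card_fin, Fin.card_filter_val_lt] at h2
  rw [Finset.card_product, Fin.card_filter_val_lt, Nat.eq_sub_of_add_eq' h2] at h1
  refine h1.trans ?_
  obtain h | h := le_total a n
  · rw [min_eq_right h]
  · simp [h]

theorem heckeOp_one (n : ℕ) : heckeOp R (1 : Equiv.Perm (Fin n)) = 1 :=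
  heckeOp_of_not_descent R fun i ⟨h, hd⟩ => by simp [Fin.lt_def] at hd

theorem len_one (n : ℕ) : len (1 : Equiv.Perm (Fin n)) = 0 := by
  simp only [len, Finset.card_eq_zero, Finset.filter_eq_empty_iff]
  rintro ⟨x, y⟩ _
  simp only [Equiv.Perm.one_apply, not_and, not_lt]
  exact fun h => h.le

theorem eq_one_of_monotone {n : ℕ} {σ : Equiv.Perm (Fin n)} (h : ∀ i j, i < j → σ i < σ j) :
    σ = 1 := by
  ext1 x
  have h1 : StrictMono σ := fun i j hij => h i j hij
  have h2 : h1.orderIsoOfSurjective σ σ.surjective = OrderIso.refl _ := Subsingleton.elim _ _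
  exact DFunLike.congr_fun h2 x

end heckeOp

end

section

/-! ### Operators acting on the first `m` tensor factors -/

section localOps

variable (R : V ⊗[k] V →ₗ[k] V ⊗[k] V)

/-- The algebra generated by the operators `T_i` acting on the first `m` tensor factors. -/
def localOps (m : ℕ) : Subalgebra k (Module.End k (TensorAlgebra k V)) :=
  Algebra.adjoin k {X | ∃ s, s + 2 ≤ m ∧ X = act R s}

variable {R} {q : k}

theorem act_mem_localOps {s m : ℕ} (h : s + 2 ≤ m) : act R s ∈ localOps R m :=
  Algebra.subset_adjoin ⟨s, h, rfl⟩

theorem heckeOp_mem_localOps {n : ℕ} (σ : Equiv.Perm (Fin n)) : heckeOp R σ ∈ localOps R n := by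
  induction hl : len σ using Nat.strong_induction_on generalizing σ with
  | _ l ih =>
    rw [heckeOp]
    split_ifs with h
    · exact mul_mem (ih _ (hl ▸ len_mul_adj_lt σ _ h.choose_spec) _ rfl)
        (act_mem_localOps (by have := h.choose_spec.choose; omega))
    · exact one_mem _

theorem moveOp_mem_localOps {p m : ℕ} (h : p + 1 ≤ m) : moveOp R p ∈ localOps R m := by
  induction p with
  | zero => exact one_mem _
  | succ p ih => exact mul_mem (ih (by omega)) (act_mem_localOps (by omega))

theorem mem_tens_of_mem_localOps {m : ℕ} {X : Module.End k (TensorAlgebra k V)}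
    (hX : X ∈ localOps R m) {n : ℕ} {x : TensorAlgebra k V} (hx : x ∈ tens k V n) :
    X x ∈ tens k V n := by
  induction hX using Algebra.adjoin_induction generalizing x with
  | mem X h => obtain ⟨s, _, rfl⟩ := h; exact act_mem_tens R s n hx
  | algebraMap c =>
    rw [Algebra.algebraMap_eq_smul_one]
    exact Submodule.smul_mem _ c hx
  | add X Y _ _ hX hY => exact add_mem (hX hx) (hY hx)
  | mul X Y _ _ hX hY => exact hX (hY hx)

/-- Operators built from the first m factors ignore whatever stands to the right of them. -/
theorem localOps_mul {m : ℕ} {X : Module.End k (TensorAlgebra k V)}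
    (hX : X ∈ localOps R m) {u : TensorAlgebra k V} (hu : u ∈ tens k V m)
    (w : TensorAlgebra k V) : X (u * w) = X u * w := by
  induction hX using Algebra.adjoin_induction generalizing u with
  | mem X h => obtain ⟨s, hs, rfl⟩ := h; exact act_mul R hs hu w
  | algebraMap c => simp [Algebra.algebraMap_eq_smul_one]
  | add X Y _ _ hX hY => simp [hX hu, hY hu, add_mul]
  | mul X Y _ hY' hX hY =>
    rw [Module.End.mul_apply, hY hu, hX (mem_tens_of_mem_localOps hY' hu), Module.End.mul_apply]

theorem moveOp_mem_tens (p : ℕ) {n : ℕ} {x : TensorAlgebra k V} (hx : x ∈ tens k V n) :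
    moveOp R p x ∈ tens k V n :=
  mem_tens_of_mem_localOps (moveOp_mem_localOps le_rfl) hx

theorem moveOp_mul {p m : ℕ} (h : p + 1 ≤ m) {u : TensorAlgebra k V} (hu : u ∈ tens k V m)
    (w : TensorAlgebra k V) : moveOp R p (u * w) = moveOp R p u * w :=
  localOps_mul (moveOp_mem_localOps h) hu w

theorem moveOp_mul_act_of_lt {s j : ℕ} (h : s + 1 ≤ j) :
    moveOp R s * act R j = act R j * moveOp R s := by
  induction s with
  | zero => simp [moveOp]
  | succ s ih =>
    rw [moveOp, mul_assoc, act_comm R (by omega), ← mul_assoc, ih (by omega), mul_assoc]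

/-- The braid relation lets T_s pass the cycle T_0 ⋯ T_{i-1}, coming out as T_{s+1}: bringing a
factor to the front pushes the earlier factors one place to the right. -/
theorem moveOp_mul_act (hR : IsHeckeSymmetry R q) {s i : ℕ} (h : s + 1 < i) :
    moveOp R i * act R s = act R (s + 1) * moveOp R i := by
  induction i with
  | zero => omega
  | succ i ih =>
    obtain h | rfl : s + 1 < i ∨ i = s + 1 := by omega
    · rw [moveOp, mul_assoc, ← act_comm R (by omega), ← mul_assoc, ih h, mul_assoc]
    · have h1 := congrArg (moveOp R s * ·) (act_braid hR s)
      have h2 := moveOp_mul_act_of_lt (R := R) (le_refl (s + 1))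
      simp only [moveOp, ← mul_assoc] at h1 ⊢
      rw [h1, h2]

/-- After factor i has been brought to the front, X acts as Id ⊗ X and does not see the contracted
factor. -/
theorem contr_moveOp (hR : IsHeckeSymmetry R q) (ξ : Module.Dual k V) {i : ℕ}
    {X : Module.End k (TensorAlgebra k V)} (hX : X ∈ localOps R i) (x : TensorAlgebra k V) :
    contr ξ (moveOp R i (X x)) = X (contr ξ (moveOp R i x)) := by
  induction hX using Algebra.adjoin_induction generalizing x with
  | mem X h =>
    obtain ⟨s, hs, rfl⟩ := h
    rw [← Module.End.mul_apply (moveOp R i), moveOp_mul_act hR (by omega : s + 1 < i),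
      Module.End.mul_apply, act_succ, contr_shift]
  | algebraMap c => simp [Algebra.algebraMap_eq_smul_one]
  | add X Y _ _ hX hY => simp [hX, hY]
  | mul X Y _ _ hX hY => rw [Module.End.mul_apply, hX, hY, Module.End.mul_apply]

theorem moveOp_add_mul (a p : ℕ) {u : TensorAlgebra k V} (hu : u ∈ tens k V a)
    (w : TensorAlgebra k V) : moveOp R (a + p) (u * w) = moveOp R a (u * moveOp R p w) := by
  induction p generalizing w with
  | zero => simp [moveOp]
  | succ p ih =>
    rw [← add_assoc, moveOp, Module.End.mul_apply, add_comm a p, act_add_mul R a p hu, add_comm p a,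
      ih, moveOp, Module.End.mul_apply]

end localOps

/-! ### Recursions for the antisymmetrizers -/

section antisym

variable (R : V ⊗[k] V →ₗ[k] V ⊗[k] V) (q : k)

open Classical in
/-- The partial antisymmetrizer `y_{n/a,n-a}`. -/
def splitAntisym (n a : ℕ) : Module.End k (TensorAlgebra k V) :=
  ∑ σ : Equiv.Perm (Fin n) with IsSplitMono a σ,
    ((-1) ^ len σ * q ^ (a * (n - a) - len σ)) • heckeOp R σ

/-- Keeping the total degree as an independent index avoids casts in the recursions. -/
theorem shuffleAntisym_eq (a b : ℕ) : shuffleAntisym R q a b = splitAntisym R q (a + b) a := by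
  simp only [shuffleAntisym, splitAntisym, Nat.add_sub_cancel_left]
  rfl

/-- The operator `∑_p (-1)^p q^{m-p} T_0 ⋯ T_{p-1}` on tensors of degree `m + 1`. -/
def frontOp (m : ℕ) : Module.End k (TensorAlgebra k V) :=
  ∑ p ∈ Finset.range (m + 1), ((-1) ^ p * q ^ (m - p)) • moveOp R p

variable {R q}

theorem splitAntisym_mem_localOps (n a : ℕ) : splitAntisym R q n a ∈ localOps R n :=
  Subalgebra.sum_mem _ fun σ _ => Subalgebra.smul_mem _ (heckeOp_mem_localOps σ) _

theorem antisym_mem_localOps (n : ℕ) : antisym R q n ∈ localOps R n :=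
  Subalgebra.sum_mem _ fun σ _ => Subalgebra.smul_mem _ (heckeOp_mem_localOps σ) _

theorem frontOp_mem_localOps (m : ℕ) : frontOp R q m ∈ localOps R (m + 1) :=
  Subalgebra.sum_mem _ fun p hp => Subalgebra.smul_mem _
    (moveOp_mem_localOps (by have := Finset.mem_range.mp hp; omega)) _

theorem splitAntisym_mem_tens (n a : ℕ) {m : ℕ} {x : TensorAlgebra k V} (hx : x ∈ tens k V m) :
    splitAntisym R q n a x ∈ tens k V m :=
  mem_tens_of_mem_localOps (splitAntisym_mem_localOps n a) hx

theorem antisym_mem_tens (n : ℕ) {m : ℕ} {x : TensorAlgebra k V} (hx : x ∈ tens k V m) :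
    antisym R q n x ∈ tens k V m :=
  mem_tens_of_mem_localOps (antisym_mem_localOps n) hx

theorem frontOp_mem_tens (n : ℕ) {m : ℕ} {x : TensorAlgebra k V} (hx : x ∈ tens k V m) :
    frontOp R q n x ∈ tens k V m :=
  mem_tens_of_mem_localOps (frontOp_mem_localOps n) hx

theorem splitAntisym_eq_one {n a : ℕ}
    (h : ∀ σ : Equiv.Perm (Fin n), IsSplitMono a σ → σ = 1) (h0 : a * (n - a) = 0) :
    splitAntisym R q n a = 1 := by
  have h1 : IsSplitMono a (1 : Equiv.Perm (Fin n)) := fun i j hij _ => hij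
  classical
  rw [splitAntisym, Finset.sum_eq_single 1]
  · simp [len_one, h0, heckeOp_one]
  · intro σ hσ hne
    exact absurd (h σ (Finset.mem_filter.mp hσ).2) hne
  · simp [h1]

theorem splitAntisym_zero (n : ℕ) : splitAntisym R q n 0 = 1 :=
  splitAntisym_eq_one (fun _ h => eq_one_of_monotone fun i j hij => h i j hij (Or.inr (by omega)))
    (by simp)

theorem splitAntisym_self (n : ℕ) : splitAntisym R q n n = 1 :=
  splitAntisym_eq_one (fun _ h => eq_one_of_monotone fun i j hij => h i j hij (Or.inl (by omega)))
    (by simp)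

theorem antisym_zero : antisym R q 0 = 1 := by
  rw [antisym, Fintype.sum_unique]
  have : (default : Equiv.Perm (Fin 0)) = 1 := Subsingleton.elim _ _
  rw [this, len_one, heckeOp_one]
  simp

theorem extend_mul_cycleRange_succAbove {m : ℕ} (σ : Equiv.Perm (Fin m)) (p : Fin (m + 1))
    (x : Fin m) : (extend σ * p.cycleRange) (p.succAbove x) = (σ x).succ := by
  rw [Equiv.Perm.mul_apply, Fin.cycleRange_succAbove, extend_succ]

theorem extend_mul_cycleRange_self {m : ℕ} (σ : Equiv.Perm (Fin m)) (p : Fin (m + 1)) :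
    (extend σ * p.cycleRange) p = 0 := by
  rw [Equiv.Perm.mul_apply, Fin.cycleRange_self, extend_zero]

/-- The minimal value of a map increasing on two nonempty blocks occurs at the start of one of them;
deleting it shortens that block. -/
theorem isSplitMono_extend_iff {m a : ℕ} (h : a + 1 ≤ m) (σ : Equiv.Perm (Fin m))
    (p : Fin (m + 1)) : IsSplitMono (a + 1) (extend σ * p.cycleRange) ↔
      ((p : ℕ) = 0 ∧ IsSplitMono a σ) ∨ ((p : ℕ) = a + 1 ∧ IsSplitMono (a + 1) σ) := by
  have hval : ∀ x : Fin m, (p.succAbove x : ℕ) = if (x : ℕ) < p then (x : ℕ) else x + 1 := by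
    intro x
    simp only [Fin.succAbove, Fin.lt_def, Fin.val_castSucc]
    split_ifs <;> simp
  constructor
  · intro H
    have hp : (p : ℕ) = 0 ∨ (p : ℕ) = a + 1 := by
      by_contra hne
      by_cases hlt : (p : ℕ) < a + 1
      · have := H 0 p (Fin.lt_def.mpr (by rw [Fin.val_zero]; omega)) (Or.inl hlt)
        rw [extend_mul_cycleRange_self] at this
        exact absurd this (by simp)
      · have := H ⟨a + 1, by omega⟩ p (Fin.lt_def.mpr (by simp; omega)) (Or.inr le_rfl)
        rw [extend_mul_cycleRange_self] at this
        exact absurd this (by simp)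
    refine hp.imp (fun hp => ⟨hp, fun i j hij hc => ?_⟩) (fun hp => ⟨hp, fun i j hij hc => ?_⟩) <;>
    · have := H (p.succAbove i) (p.succAbove j) (Fin.succAbove_lt_succAbove_iff.mpr hij) (by
        rw [hval, hval]; split_ifs <;> omega)
      rw [extend_mul_cycleRange_succAbove, extend_mul_cycleRange_succAbove] at this
      exact Fin.succ_lt_succ_iff.mp this
  · intro H i j hij hc
    by_cases hi : i = p
    · subst hi
      obtain ⟨y, rfl⟩ := Fin.exists_succAbove_eq hij.ne'
      rw [extend_mul_cycleRange_self, extend_mul_cycleRange_succAbove]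
      exact Fin.succ_pos _
    by_cases hj : j = p
    · subst hj
      have := Fin.lt_def.mp hij
      omega
    obtain ⟨x, rfl⟩ := Fin.exists_succAbove_eq hi
    obtain ⟨y, rfl⟩ := Fin.exists_succAbove_eq hj
    rw [extend_mul_cycleRange_succAbove, extend_mul_cycleRange_succAbove, Fin.succ_lt_succ_iff]
    rw [hval, hval] at hc
    have hxy := Fin.succAbove_lt_succAbove_iff.mp hij
    have hxy' := Fin.lt_def.mp hxy
    obtain ⟨hp, H⟩ | ⟨hp, H⟩ := H <;>
    · refine H x y hxy ?_
      split_ifs at hc <;> omega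

theorem contr_heckeOp_extend_mul_cycleRange (hR : IsHeckeSymmetry R q) {m : ℕ}
    (σ : Equiv.Perm (Fin m)) (p : Fin (m + 1)) (ξ : Module.Dual k V) (x : TensorAlgebra k V) :
    contr ξ (heckeOp R (extend σ * p.cycleRange) x) =
      heckeOp R σ (contr ξ (moveOp R p x)) := by
  rw [← contr_heckeOp_extend hR, ← Module.End.mul_apply (heckeOp R (extend σ)),
    ← heckeOp_extend_mul_cycleRange hR σ p.2]

/-- The q-Pascal recursion: the first output factor comes from the first or the second block. In the
first case no length is added and the exponent (a+1)(m-a) exceeds a(m-a) by m-a. In the second the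
added length a+1 cancels the change of exponent, leaving a sign. -/
theorem contr_splitAntisym (hR : IsHeckeSymmetry R q) {m a : ℕ} (h : a + 1 ≤ m)
    (ξ : Module.Dual k V) (x : TensorAlgebra k V) :
    contr ξ (splitAntisym R q (m + 1) (a + 1) x) =
      q ^ (m - a) • splitAntisym R q m a (contr ξ x) +
      (-1 : k) ^ (a + 1) • splitAntisym R q m (a + 1) (contr ξ (moveOp R (a + 1) x)) := by
  classical
  have h0 : (0 : Fin (m + 1)) ≠ ⟨a + 1, by omega⟩ := by simp [Fin.ext_iff]
  simp only [splitAntisym, Finset.sum_filter, sum_perm_succ]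
  simp only [LinearMap.sum_apply, map_sum, Finset.smul_sum]
  rw [Fintype.sum_eq_add _ _ h0]
  · congr 1
    · refine Finset.sum_congr rfl fun σ _ => ?_
      have h1 := isSplitMono_extend_iff h σ 0
      have h2 : IsSplitMono (a + 1) (extend σ * Fin.cycleRange 0) ↔ IsSplitMono a σ := by
        rw [h1]; simp
      by_cases hσ : IsSplitMono a σ
      · rw [if_pos hσ, if_pos (h2.mpr hσ), LinearMap.smul_apply, map_smul,
          contr_heckeOp_extend_mul_cycleRange hR, LinearMap.smul_apply, smul_smul]
        have h3 := len_extend_mul_cycleRange σ (p := 0) (by omega)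
        have h4 := len_le_of_isSplitMono hσ
        change len (extend σ * Fin.cycleRange 0) = _ at h3
        have h5 : (a + 1) * (m + 1 - (a + 1)) = a * (m - a) + (m - a) := by
          rw [Nat.add_sub_add_right, add_mul, one_mul]
        rw [h3, add_zero, h5, Nat.sub_add_comm h4, pow_add]
        simp only [Fin.val_zero, moveOp, Module.End.one_apply]
        congr 1
        ring
      · rw [if_neg hσ, if_neg (mt h2.mp hσ)]; simp
    · refine Finset.sum_congr rfl fun σ _ => ?_
      have h1 := isSplitMono_extend_iff h σ ⟨a + 1, by omega⟩
      have h2 : IsSplitMono (a + 1) (extend σ * Fin.cycleRange ⟨a + 1, by omega⟩) ↔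
          IsSplitMono (a + 1) σ := by
        rw [h1]; simp
      by_cases hσ : IsSplitMono (a + 1) σ
      · rw [if_pos hσ, if_pos (h2.mpr hσ), LinearMap.smul_apply, map_smul,
          contr_heckeOp_extend_mul_cycleRange hR, LinearMap.smul_apply, smul_smul]
        have h5 : (a + 1) * (m + 1 - (a + 1)) - (len σ + (a + 1))
            = (a + 1) * (m - (a + 1)) - len σ := by
          have : (a + 1) * (m + 1 - (a + 1)) = (a + 1) * (m - (a + 1)) + (a + 1) := by
            rw [← Nat.mul_succ]; congr 1; omega
          omega
        rw [len_extend_mul_cycleRange, h5]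
        congr 1
        ring
      · rw [if_neg hσ, if_neg (mt h2.mp hσ)]; simp
  · rintro p ⟨hp0, hp1⟩
    refine Finset.sum_eq_zero fun σ _ => ?_
    rw [if_neg]
    · simp
    · rw [isSplitMono_extend_iff h]
      rintro (⟨h, _⟩ | ⟨h, _⟩)
      · exact hp0 (Fin.ext h)
      · exact hp1 (Fin.ext h)

/-- The sum over S_{m+1} factors along (1 × σ)(0 1 … p): the sum over p is `frontOp` and the sum
over σ is y_m on the other factors. -/
theorem contr_antisym (hR : IsHeckeSymmetry R q) (m : ℕ) (ξ : Module.Dual k V)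
    (x : TensorAlgebra k V) :
    contr ξ (antisym R q (m + 1) x) = antisym R q m (contr ξ (frontOp R q m x)) := by
  rw [antisym, frontOp, Finset.sum_range, sum_perm_succ]
  simp only [LinearMap.sum_apply, map_sum]
  refine Finset.sum_congr rfl fun p _ => ?_
  rw [antisym, LinearMap.sum_apply]
  refine Finset.sum_congr rfl fun σ _ => ?_
  simp only [LinearMap.smul_apply, map_smul, contr_heckeOp_extend_mul_cycleRange hR, smul_smul]
  have h1 := len_le σ
  have h3 := Finset.sum_range_id_mul_two m
  have h4 := Finset.sum_range_id_mul_two (m + 1)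
  rw [Finset.sum_range_succ] at h4
  have h5 : (m + 1) * (m + 1 - 1) / 2 - (len σ + p) = (m - p) + (m * (m - 1) / 2 - len σ) := by
    have := p.2
    omega
  rw [len_extend_mul_cycleRange, h5]
  congr 1
  ring

/-- The factor brought to the front lies in u or in w. In the latter case it is first brought to the
front of w and then past u. -/
theorem frontOp_mul (a b : ℕ) {u w : TensorAlgebra k V} (hu : u ∈ tens k V (a + 1)) :
    frontOp R q (a + (b + 1)) (u * w) = q ^ (b + 1) • (frontOp R q a u * w) +
      (-1 : k) ^ (a + 1) • moveOp R (a + 1) (u * frontOp R q b w) := by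
  have h : a + (b + 1) + 1 = (a + 1) + (b + 1) := by ring
  rw [frontOp, h, Finset.sum_range_add]
  simp only [LinearMap.add_apply, LinearMap.sum_apply, frontOp, LinearMap.smul_apply,
    Finset.smul_sum, Finset.sum_mul, Finset.mul_sum, map_sum]
  congr 1
  · refine Finset.sum_congr rfl fun p hp => ?_
    have hp' := Finset.mem_range.mp hp
    rw [moveOp_mul (by omega) hu, smul_mul_assoc, smul_smul]
    congr 1
    rw [show a + (b + 1) - p = (b + 1) + (a - p) by omega, pow_add]
    ring
  · refine Finset.sum_congr rfl fun p hp => ?_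
    rw [moveOp_add_mul _ _ hu, mul_smul_comm, map_smul, smul_smul]
    congr 1
    rw [show a + (b + 1) - (a + 1 + p) = b - p by omega, pow_add]
    ring

variable [FiniteDimensional k V]

theorem antisym_succ_apply (hR : IsHeckeSymmetry R q) {m : ℕ} {x : TensorAlgebra k V}
    (hx : x ∈ tens k V (m + 1)) :
    antisym R q (m + 1) x = shift (antisym R q m) (frontOp R q m x) := by
  refine eq_of_contr_eq (antisym_mem_tens _ hx) (shift_mul_mem_tens
    (fun n x hx => antisym_mem_tens _ hx) _ (frontOp_mem_tens _ hx)) fun ξ => ?_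
  rw [contr_antisym hR, contr_shift]

theorem splitAntisym_succ_apply (hR : IsHeckeSymmetry R q) {m a n : ℕ} (h : a + 1 ≤ m)
    {x : TensorAlgebra k V} (hx : x ∈ tens k V (n + 1)) :
    splitAntisym R q (m + 1) (a + 1) x = q ^ (m - a) • shift (splitAntisym R q m a) x +
      (-1 : k) ^ (a + 1) • shift (splitAntisym R q m (a + 1)) (moveOp R (a + 1) x) := by
  have h1 : ∀ c : ℕ, ∀ n, ∀ x ∈ tens k V n, splitAntisym R q m c x ∈ tens k V n :=
    fun c n x hx => splitAntisym_mem_tens _ _ hx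
  refine eq_of_contr_eq (splitAntisym_mem_tens _ _ hx) (add_mem
    (Submodule.smul_mem _ _ (shift_mul_mem_tens (h1 a) _ hx))
    (Submodule.smul_mem _ _ (shift_mul_mem_tens (h1 _) _ (moveOp_mem_tens _ hx)))) fun ξ => ?_
  rw [contr_splitAntisym hR h, map_add, map_smul, map_smul, contr_shift, contr_shift]

/-- `y_{i+j} (u w) = y_{i+j/i,j} (y_i u · y_j w)`. -/
theorem antisym_mul (hR : IsHeckeSymmetry R q) {n i j : ℕ} (h : i + j = n)
    {u w : TensorAlgebra k V} (hu : u ∈ tens k V i) (hw : w ∈ tens k V j) :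
    antisym R q n (u * w) = splitAntisym R q n i (antisym R q i u * antisym R q j w) := by
  induction n generalizing i j u w with
  | zero =>
    obtain rfl : i = 0 := by omega
    obtain rfl : j = 0 := by omega
    simp [antisym_zero, splitAntisym_zero]
  | succ n ih =>
    obtain _ | a := i
    · obtain rfl : j = n + 1 := by omega
      obtain ⟨c, rfl⟩ := mem_tens_zero hu
      simp [splitAntisym_zero, antisym_zero]
    obtain _ | b := j
    · obtain rfl : a = n := by omega
      obtain ⟨c, rfl⟩ := mem_tens_zero hw
      simp [splitAntisym_self, antisym_zero]
    obtain rfl : n = a + (b + 1) := by omega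
    have hyu : antisym R q (a + 1) u ∈ tens k V (a + 1) := antisym_mem_tens _ hu
    have hyw : antisym R q (b + 1) w ∈ tens k V (b + 1) := antisym_mem_tens _ hw
    refine eq_of_contr_eq (antisym_mem_tens _ (mul_mem_tens h hu hw))
      (splitAntisym_mem_tens _ _ (mul_mem_tens h hyu hyw)) fun ξ => ?_
    rw [contr_antisym hR, contr_splitAntisym hR (by omega), frontOp_mul _ _ hu, map_add, map_add,
      map_smul, map_smul, map_smul, map_smul, contr_mul ξ (frontOp_mem_tens _ hu),
      contr_mul ξ hyu, ih rfl (contr_mem_tens ξ (frontOp_mem_tens _ hu)) hw, contr_antisym hR,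
      show a + (b + 1) - a = b + 1 by omega]
    congr 2
    -- The summands with first factor from u agree by induction. For the others, y_{b+1}w = (Id ⊗
    -- y_b)z with z = `frontOp` applied to w. For z = vy the induction hypothesis for (a+1, b)
    -- applies, because y_{a+1} commutes with bringing v past u and contracting it.
    rw [antisym_succ_apply hR hw]
    have hz := frontOp_mem_tens (R := R) (q := q) b hw
    generalize frontOp R q b w = z at hz
    refine tens_succ_induction (fun v y hy => ?_) (fun x y hx hy => ?_) hz
    · have h1 : ∀ {u}, u ∈ tens k V (a + 1) → ∀ y, contr ξ (moveOp R (a + 1)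
          (u * (TensorAlgebra.ι k v * y))) =
          contr ξ (moveOp R (a + 1) (u * TensorAlgebra.ι k v)) * y := by
        intro u hu y
        have h2 : u * TensorAlgebra.ι k v ∈ tens k V (a + 1 + 1) :=
          mul_mem_tens rfl hu (ι_mem_tens v)
        rw [← mul_assoc, moveOp_mul le_rfl h2, contr_mul ξ (moveOp_mem_tens _ h2)]
      rw [shift_ι_mul, h1 hu, h1 hyu, ih (by omega) (contr_mem_tens ξ (moveOp_mem_tens _
        (mul_mem_tens rfl hu (ι_mem_tens v)))) hy, ← contr_moveOp hR ξ (antisym_mem_localOps _),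
        localOps_mul (antisym_mem_localOps _) hu]
    · simp only [mul_add, map_add, hx, hy]

end antisym

end

section

variable {R : V ⊗[k] V →ₗ[k] V ⊗[k] V} {q : k}

/-! ### The spaces `Υ^{(n)}` are stable under the star multiplication -/

theorem mem_upsilon_iff {n : ℕ} {x : TensorAlgebra k V} :
    x ∈ upsilon R q n ↔ x ∈ tens k V n ∧
      ∀ i, i + 1 < n → ∃ y ∈ tens k V n, act R i y - q • y = x := by
  simp only [upsilon, Submodule.mem_inf, Submodule.mem_iInf, Finset.mem_range, Submodule.mem_map,
    Nat.lt_sub_iff_add_lt]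
  rfl

theorem upsilon_le_tens (n : ℕ) : upsilon R q n ≤ tens k V n := inf_le_left

theorem upsilon_zero : upsilon R q 0 = tens k V 0 := by simp [upsilon]

theorem upsilon_one : upsilon R q 1 = tens k V 1 := by simp [upsilon]

theorem contr_mem_upsilon (ξ : Module.Dual k V) {n : ℕ} {x : TensorAlgebra k V}
    (hx : x ∈ upsilon R q (n + 1)) : contr ξ x ∈ upsilon R q n := by
  rw [mem_upsilon_iff] at hx ⊢
  refine ⟨contr_mem_tens ξ hx.1, fun i hi => ?_⟩
  obtain ⟨y, hy, h⟩ := hx.2 (i + 1) (by omega)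
  refine ⟨contr ξ y, contr_mem_tens ξ hy, ?_⟩
  rw [← h, map_sub, map_smul, act_succ, contr_shift]

/-- The conditions for T_i with i ≥ 1 do not involve the first factor and can be checked on
contractions; only T_0 remains. -/
theorem mem_upsilon_succ [FiniteDimensional k V] {n : ℕ} {x : TensorAlgebra k V}
    (hx : x ∈ tens k V (n + 1)) (h : ∀ ξ : Module.Dual k V, contr ξ x ∈ upsilon R q n)
    (h0 : 1 ≤ n → ∃ y ∈ tens k V (n + 1), act R 0 y - q • y = x) : x ∈ upsilon R q (n + 1) := by
  rw [mem_upsilon_iff]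
  refine ⟨hx, fun i hi => ?_⟩
  obtain _ | i := i
  · exact h0 (by omega)
  let e := Module.finBasis k V
  have h1 : ∀ s, ∃ y ∈ tens k V n, act R i y - q • y = contr (e.coord s) x := fun s =>
    (mem_upsilon_iff.mp (h (e.coord s))).2 i (by omega)
  choose y hy h2 using h1
  refine ⟨∑ s, TensorAlgebra.ι k (e s) * y s, sum_mem fun s _ => ι_mul_mem_tens _ (hy s), ?_⟩
  conv_rhs => rw [← sum_ι_mul_contr e hx]
  simp only [← h2, map_sum, act_succ, shift_ι_mul, mul_sub, Finset.sum_sub_distrib,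
    Finset.smul_sum, mul_smul_comm]

theorem contr_moveOp_mul (ξ : Module.Dual k V) {i : ℕ} {a : TensorAlgebra k V}
    (ha : a ∈ tens k V i) (v : V) (y : TensorAlgebra k V) :
    contr ξ (moveOp R i (a * (TensorAlgebra.ι k v * y))) =
      contr ξ (moveOp R i (a * TensorAlgebra.ι k v)) * y := by
  have h2 : a * TensorAlgebra.ι k v ∈ tens k V (i + 1) := mul_mem_tens rfl ha (ι_mem_tens v)
  rw [← mul_assoc, moveOp_mul le_rfl h2, contr_mul ξ (moveOp_mem_tens _ h2)]

theorem contr_moveOp_mul_mem_tens (ξ : Module.Dual k V) {i : ℕ} {a : TensorAlgebra k V}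
    (ha : a ∈ tens k V i) (v : V) :
    contr ξ (moveOp R i (a * TensorAlgebra.ι k v)) ∈ tens k V i :=
  contr_mem_tens ξ (moveOp_mem_tens _ (mul_mem_tens rfl ha (ι_mem_tens v)))

/-- By `contr_moveOp` the map in a commutes with every T_s on the i factors, so it preserves the
images of T_s - q. -/
theorem contr_moveOp_mul_mem_upsilon (hR : IsHeckeSymmetry R q) (ξ : Module.Dual k V) {i : ℕ}
    {a : TensorAlgebra k V} (ha : a ∈ upsilon R q i) (v : V) :
    contr ξ (moveOp R i (a * TensorAlgebra.ι k v)) ∈ upsilon R q i := by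
  rw [mem_upsilon_iff]
  refine ⟨contr_moveOp_mul_mem_tens ξ (upsilon_le_tens i ha) v, fun s hs => ?_⟩
  obtain ⟨z, hz, rfl⟩ := (mem_upsilon_iff.mp ha).2 s hs
  refine ⟨_, contr_moveOp_mul_mem_tens (R := R) ξ hz v, ?_⟩
  rw [← contr_moveOp hR ξ (act_mem_localOps hs), act_mul R hs hz, sub_mul, map_sub, map_sub,
    smul_mul_assoc, map_smul, map_smul]

theorem shift_congr {X Y : Module.End k (TensorAlgebra k V)} {n : ℕ}
    (h : ∀ y ∈ tens k V n, X y = Y y) {x : TensorAlgebra k V} (hx : x ∈ tens k V (n + 1)) :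
    shift X x = shift Y x := by
  refine tens_succ_induction (fun v y hy => ?_) (fun x y hx hy => ?_) hx
  · rw [shift_ι_mul, shift_ι_mul, h y hy]
  · rw [map_add, map_add, hx, hy]

theorem moveOp_succ_apply (a : ℕ) {n : ℕ} {x : TensorAlgebra k V} (hx : x ∈ tens k V (n + 1)) :
    moveOp R (a + 1) x = act R 0 (shift (moveOp R a) x) := by
  induction a generalizing x with
  | zero => rw [moveOp, moveOp, shift_one_apply hx]; rfl
  | succ a ih =>
    rw [moveOp, Module.End.mul_apply, ih (act_mem_tens R _ _ hx), moveOp, shift_mul]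
    rfl

/-- The operator (T_1 ⋯ T_i)(T_0 ⋯ T_{i-1}) carries the pair of factors i, i+1 to the places 0, 1,
and so intertwines T_i with T_0. -/
theorem shift_moveOp_mul_moveOp (hR : IsHeckeSymmetry R q) (i : ℕ) {n : ℕ}
    {x : TensorAlgebra k V} (hx : x ∈ tens k V (n + 1)) :
    shift (moveOp R i) (moveOp R i (act R i x)) =
      act R 0 (shift (moveOp R i) (moveOp R i x)) := by
  induction i generalizing x with
  | zero =>
    rw [moveOp, Module.End.one_apply, Module.End.one_apply, shift_one_apply hx,
      shift_one_apply (act_mem_tens R _ _ hx)]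
  | succ i ih =>
    have h1 : ∀ y, act R (i + 1) (moveOp R i y) = moveOp R i (act R (i + 1) y) := fun y =>
      (LinearMap.congr_fun (moveOp_mul_act_of_lt (R := R) (le_refl (i + 1))) y).symm
    have h2 : ∀ y, act R i (act R (i + 1) (act R i y)) =
        act R (i + 1) (act R i (act R (i + 1) y)) :=
      fun y => LinearMap.congr_fun (act_braid hR i) y
    simp only [moveOp, shift_mul, Module.End.mul_apply, ← act_succ]
    rw [h1, ← h2, ih (act_mem_tens R _ _ (act_mem_tens R _ _ hx)), h1]

/-- Using the recursion twice sorts the shuffles by the blocks that supply the first two output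
factors. If both come from u or both from w, the term lies in the image M of T_0 - q by assumption
on u or w; the two mixed terms combine to a multiple of T_0 - q. When a or b is 0 the corresponding
unmixed term is absent, so nothing is assumed. -/
theorem splitAntisym_mul_mem_range (hR : IsHeckeSymmetry R q) [FiniteDimensional k V] {a b : ℕ}
    {u w : TensorAlgebra k V} (hu : u ∈ tens k V (a + 1)) (hw : w ∈ tens k V (b + 1))
    (hu' : 1 ≤ a → ∃ y ∈ tens k V (a + 1), act R 0 y - q • y = u)
    (hw' : 1 ≤ b → ∃ y ∈ tens k V (b + 1), act R 0 y - q • y = w) :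
    ∃ y ∈ tens k V (a + b + 1 + 1),
      act R 0 y - q • y = splitAntisym R q (a + b + 1 + 1) (a + 1) (u * w) := by
  let M : Submodule k (TensorAlgebra k V) :=
    (tens k V (a + b + 1 + 1)).map (act R 0 - q • 1)
  have hMmem : ∀ y ∈ tens k V (a + b + 1 + 1), act R 0 y - q • y ∈ M := fun y hy => ⟨y, hy, rfl⟩
  have hM : ∀ (n c : ℕ), ∀ y ∈ M, shift (shift (splitAntisym R q n c)) y ∈ M := by
    rintro n c _ ⟨y, hy, rfl⟩
    refine ⟨shift (shift (splitAntisym R q n c)) y, shift_mul_mem_tens (fun n x hx =>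
      shift_mul_mem_tens (fun n x hx => splitAntisym_mem_tens _ _ hx) n hx) _ hy, ?_⟩
    have := LinearMap.congr_fun (act_zero_mul_shift_shift R (splitAntisym R q n c)) y
    simp only [Module.End.mul_apply] at this
    simp [this]
  have hx : u * w ∈ tens k V (a + b + 1 + 1) := mul_mem_tens (by ring) hu hw
  set x := u * w with hxdef
  set Q := shift (shift (splitAntisym R q (a + b) a)) with hQ
  have hone : ∀ y ∈ tens k V (a + b + 1 + 1), shift (shift 1) y = y := fun y hy => by
    rw [shift_congr (Y := 1) (fun z hz => shift_one_apply hz) hy, shift_one_apply hy]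
  have hz : shift (moveOp R a) x ∈ tens k V (a + b + 1 + 1) :=
    shift_mul_mem_tens (fun n x hx => moveOp_mem_tens _ hx) _ hx
  have hcx : moveOp R (a + 1) x ∈ tens k V (a + b + 1 + 1) := moveOp_mem_tens _ hx
  -- The discarded term takes both factors from u. M is stable under Id ⊗ Id ⊗ X, which commutes
  -- with T_0.
  have E1 : shift (splitAntisym R q (a + b + 1) a) x -
      (-1 : k) ^ a • Q (shift (moveOp R a) x) ∈ M := by
    obtain _ | a := a
    · rw [splitAntisym_zero, hQ, splitAntisym_zero, moveOp, shift_one_apply hx, hone x hx]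
      simp
    · have h1 := shift_congr (X := splitAntisym R q (a + 1 + b + 1) (a + 1))
        (Y := q ^ (a + 1 + b - a) • shift (splitAntisym R q (a + 1 + b) a) +
          (-1 : k) ^ (a + 1) • (shift (splitAntisym R q (a + 1 + b) (a + 1)) * moveOp R (a + 1)))
        (fun y hy => splitAntisym_succ_apply hR (by omega) hy) hx
      rw [h1, shift_add, shift_smul, shift_smul, shift_mul, LinearMap.add_apply,
        LinearMap.smul_apply, LinearMap.smul_apply, Module.End.mul_apply, add_sub_cancel_right]
      refine M.smul_mem _ (hM _ _ _ ?_)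
      obtain ⟨y, hy, hyu⟩ := hu' (by omega)
      have := hMmem (y * w) (mul_mem_tens (by ring) hy hw)
      rwa [act_mul R (by omega) hy, ← smul_mul_assoc, ← sub_mul, hyu] at this
  -- The discarded term takes both factors from w, where x lies in the image of T_{a+1} - q; moving
  -- the pair to the front turns this into T_0 - q.
  have E2 : shift (splitAntisym R q (a + b + 1) (a + 1)) (moveOp R (a + 1) x) -
      q ^ b • Q (moveOp R (a + 1) x) ∈ M := by
    obtain _ | b := b
    · simp only [add_zero] at *
      rw [splitAntisym_self, hQ, splitAntisym_self, shift_one_apply hcx, hone _ hcx]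
      simp
    · have h1 := shift_congr (X := splitAntisym R q (a + (b + 1) + 1) (a + 1))
        (Y := q ^ (a + (b + 1) - a) • shift (splitAntisym R q (a + (b + 1)) a) +
          (-1 : k) ^ (a + 1) • (shift (splitAntisym R q (a + (b + 1)) (a + 1)) *
            moveOp R (a + 1)))
        (fun y hy => splitAntisym_succ_apply hR (by omega) hy) hcx
      rw [h1, shift_add, shift_smul, shift_smul, shift_mul, LinearMap.add_apply,
        LinearMap.smul_apply, LinearMap.smul_apply, Module.End.mul_apply,
        Nat.add_sub_cancel_left, add_sub_cancel_left]
      refine M.smul_mem _ (hM _ _ _ ?_)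
      obtain ⟨y, hy, hyw⟩ := hw' (by omega)
      have huw' : u * y ∈ tens k V (a + (b + 1) + 1 + 1) := mul_mem_tens (by ring) hu hy
      have h2 : x = act R (a + 1) (u * y) - q • (u * y) := by
        rw [hxdef, ← hyw, mul_sub, mul_smul_comm, ← act_add_mul R (a + 1) 0 hu, zero_add]
      rw [h2, map_sub, map_sub, map_smul, map_smul, shift_moveOp_mul_moveOp hR _ huw']
      exact hMmem _ (shift_mul_mem_tens (fun n x hx => moveOp_mem_tens _ hx) _
        (moveOp_mem_tens _ huw'))
  have E3 : Q (act R 0 (shift (moveOp R a) x) - q • shift (moveOp R a) x) ∈ M :=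
    hM _ _ _ (hMmem _ hz)
  have key : splitAntisym R q (a + b + 1 + 1) (a + 1) x ∈ M := by
    rw [splitAntisym_succ_apply hR (by omega) hx]
    have e : a + b + 1 - a = b + 1 := by omega
    rw [e]
    -- With z the tensor in `E3`, the mixed terms are (-1)^a q^{b+1} Qz and (-1)^{a+1} q^b Q T_0 z,
    -- whose sum is (-1)^{a+1} q^b Q(T_0 - q)z.
    have := add_mem (add_mem (M.smul_mem (q ^ (b + 1)) E1) (M.smul_mem ((-1 : k) ^ (a + 1)) E2))
      (M.smul_mem ((-1 : k) ^ (a + 1) * q ^ b) E3)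
    convert this using 1
    rw [moveOp_succ_apply a hx, map_sub, map_smul]
    module
  obtain ⟨y, hy, h⟩ := key
  exact ⟨y, hy, h⟩

theorem splitAntisym_mul_mem_upsilon (hR : IsHeckeSymmetry R q) [FiniteDimensional k V]
    {n i j : ℕ} (h : i + j = n) {a b : TensorAlgebra k V} (ha : a ∈ upsilon R q i)
    (hb : b ∈ upsilon R q j) : splitAntisym R q n i (a * b) ∈ upsilon R q n := by
  induction n generalizing i j a b with
  | zero =>
    rw [upsilon_zero]
    exact splitAntisym_mem_tens _ _ (mul_mem_tens h (upsilon_le_tens _ ha) (upsilon_le_tens _ hb))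
  | succ n ih =>
    obtain _ | i := i
    · obtain rfl : j = n + 1 := by omega
      obtain ⟨c, rfl⟩ := mem_tens_zero (upsilon_le_tens _ ha)
      simpa [splitAntisym_zero] using Submodule.smul_mem _ c hb
    obtain _ | j := j
    · obtain rfl : i = n := by omega
      obtain ⟨c, rfl⟩ := mem_tens_zero (upsilon_le_tens _ hb)
      simpa [splitAntisym_self] using Submodule.smul_mem _ c ha
    have hat := upsilon_le_tens _ ha
    have hbt := upsilon_le_tens _ hb
    refine mem_upsilon_succ (splitAntisym_mem_tens _ _ (mul_mem_tens h hat hbt)) (fun ξ => ?_)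
      (fun _ => ?_)
    · rw [contr_splitAntisym hR (by omega), contr_mul ξ hat]
      refine add_mem (Submodule.smul_mem _ _ (ih (by omega) (contr_mem_upsilon ξ ha) hb))
        (Submodule.smul_mem _ _ ?_)
      rw [← sum_ι_mul_contr (Module.finBasis k V) hbt]
      simp only [Finset.mul_sum, map_sum]
      refine sum_mem fun s _ => ?_
      rw [contr_moveOp_mul ξ hat]
      exact ih (by omega) (contr_moveOp_mul_mem_upsilon hR ξ ha _) (contr_mem_upsilon _ hb)
    · obtain rfl : n = i + j + 1 := by omega
      exact splitAntisym_mul_mem_range hR hat hbt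
        (fun h => (mem_upsilon_iff.mp ha).2 0 (by omega))
        (fun h => (mem_upsilon_iff.mp hb).2 0 (by omega))

/-- By `antisym_mul` the tensor y_{n+1}(vy) is a ⋆-product of a vector and y_n y, so closure under ⋆
gives the induction. -/
theorem antisym_mem_upsilon (hR : IsHeckeSymmetry R q) [FiniteDimensional k V] {n : ℕ}
    {x : TensorAlgebra k V} (hx : x ∈ tens k V n) : antisym R q n x ∈ upsilon R q n := by
  induction n generalizing x with
  | zero => rw [upsilon_zero]; exact antisym_mem_tens _ hx
  | succ n ih =>
    refine tens_succ_induction (fun v y hy => ?_) (fun x y hx hy => ?_) hx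
    · rw [antisym_mul hR (add_comm 1 n) (ι_mem_tens v) hy]
      refine splitAntisym_mul_mem_upsilon hR (add_comm 1 n) ?_ (ih hy)
      rw [upsilon_one]
      exact antisym_mem_tens _ (ι_mem_tens v)
    · rw [map_add]; exact add_mem hx hy

/-! ### Nondegeneracy of the star multiplication in the top degree -/

/-- The Hecke relation and q ≠ 0 give the inverse T_i^{-1} = q^{-1}(T_i - (q - 1)). -/
theorem exists_act_eq (hR : IsHeckeSymmetry R q) {i n : ℕ} (h : i + 2 ≤ n) {x : TensorAlgebra k V}
    (hx : x ∈ tens k V n) : ∃ y ∈ tens k V n, act R i y = x := by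
  refine ⟨q⁻¹ • (act R i x - (q - 1) • x), Submodule.smul_mem _ _ (sub_mem (act_mem_tens R i n hx)
    (Submodule.smul_mem _ _ hx)), ?_⟩
  rw [map_smul, map_sub, map_smul, act_hecke hR h hx, add_sub_cancel_left,
    inv_smul_smul₀ hR.ne_zero]

theorem exists_moveOp_eq (hR : IsHeckeSymmetry R q) {p n : ℕ} (h : p + 1 ≤ n)
    {x : TensorAlgebra k V} (hx : x ∈ tens k V n) : ∃ y ∈ tens k V n, moveOp R p y = x := by
  induction p generalizing x with
  | zero => exact ⟨x, hx, rfl⟩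
  | succ p ih =>
    obtain ⟨y, hy, rfl⟩ := ih (by omega) hx
    obtain ⟨z, hz, rfl⟩ := exists_act_eq hR (by omega : p + 2 ≤ n) hy
    exact ⟨z, hz, rfl⟩

/-- Annihilating y_j V^{⊗j} is inherited by the tensors obtained from av by bringing v to the front
and contracting it. Since the moving operators are invertible, v · y_j w arises from some y_j x with
v still behind the j factors; moving then takes place across all of a · y_j x and commutes with
y_{n/i,j}. -/
theorem splitAntisym_contr_moveOp_eq_zero (hR : IsHeckeSymmetry R q) [FiniteDimensional k V]
    {n i j : ℕ} (h : i + j = n) {a : TensorAlgebra k V} (ha : a ∈ tens k V i)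
    (h0 : ∀ w ∈ tens k V j, splitAntisym R q n i (a * antisym R q j w) = 0)
    (ξ : Module.Dual k V) (v : V) {w : TensorAlgebra k V} (hw : w ∈ tens k V j) :
    splitAntisym R q n i
      (contr ξ (moveOp R i (a * TensorAlgebra.ι k v)) * antisym R q j w) = 0 := by
  obtain ⟨x, hx, hxw⟩ := exists_moveOp_eq hR le_rfl (ι_mul_mem_tens v hw)
  have h1 : TensorAlgebra.ι k v * antisym R q j w = moveOp R j (antisym R q j x) := by
    refine eq_of_contr_eq (ι_mul_mem_tens v (antisym_mem_tens j hw))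
      (moveOp_mem_tens _ (antisym_mem_tens j hx)) fun η => ?_
    rw [contr_moveOp hR η (antisym_mem_localOps j), hxw, contr_ι_mul, contr_ι_mul, map_smul]
  rw [← contr_moveOp_mul ξ ha, h1, ← moveOp_add_mul _ _ ha, h,
    ← contr_moveOp hR ξ (splitAntisym_mem_localOps n i)]
  suffices splitAntisym R q n i (a * antisym R q j x) = 0 by rw [this, map_zero, map_zero]
  refine tens_mul_induction (fun u hu z hz => ?_) (fun x y hx hy => ?_) hx
  · rw [localOps_mul (antisym_mem_localOps j) hu, ← mul_assoc,
      localOps_mul (splitAntisym_mem_localOps n i) (mul_mem_tens h ha (antisym_mem_tens j hu)),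
      h0 u hu, zero_mul]
  · rw [map_add, mul_add, map_add, hx, hy, add_zero]

/-- If `Υ^{(n+1)} = 0` and `y_n ≠ 0`, then the pairing between `Υ^{(i)}` and `y_j V^{⊗ j}` with
`i + j = n` has no left radical. -/
theorem eq_zero_of_splitAntisym_eq_zero (hR : IsHeckeSymmetry R q) [FiniteDimensional k V]
    {n : ℕ} (hvan : upsilon R q (n + 1) = ⊥) (hy : (tens k V n).map (antisym R q n) ≠ ⊥)
    {i j : ℕ} (h : i + j = n) {a : TensorAlgebra k V} (ha : a ∈ upsilon R q i)
    (h0 : ∀ w ∈ tens k V j, splitAntisym R q n i (a * antisym R q j w) = 0) : a = 0 := by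
  induction i generalizing j a with
  | zero =>
    obtain rfl : j = n := by omega
    obtain ⟨c, rfl⟩ := mem_tens_zero (upsilon_le_tens _ ha)
    obtain ⟨x, ⟨z, hz, rfl⟩, hne⟩ := Submodule.exists_mem_ne_zero_of_ne_bot hy
    have := h0 z hz
    rw [splitAntisym_zero, Module.End.one_apply, smul_mul_assoc, one_mul, smul_eq_zero] at this
    rw [this.resolve_right hne, zero_smul]
  | succ i ih =>
    have hat := upsilon_le_tens _ ha
    refine eq_of_contr_eq hat (zero_mem _) fun ξ => ?_
    rw [map_zero]
    refine ih (j := j + 1) (by omega) (contr_mem_upsilon ξ ha) fun w hw => ?_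
    -- This product lies in Υ^{(n+1)} = 0. In its contracted recursion the second summand vanishes
    -- by the annihilation hypothesis on a, so the first one, carrying a nonzero power of q,
    -- vanishes too. That is the hypothesis for the contraction of a.
    have h1 : splitAntisym R q (n + 1) (i + 1) (a * antisym R q (j + 1) w) = 0 := by
      have := splitAntisym_mul_mem_upsilon hR (by omega : i + 1 + (j + 1) = n + 1) ha
        (antisym_mem_upsilon hR hw)
      rwa [hvan, Submodule.mem_bot] at this
    have h2 := contr_splitAntisym hR (by omega : i + 1 ≤ n) ξ (a * antisym R q (j + 1) w)
    have h3 : splitAntisym R q n (i + 1)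
        (contr ξ (moveOp R (i + 1) (a * antisym R q (j + 1) w))) = 0 := by
      rw [antisym_succ_apply hR hw]
      refine tens_succ_induction (fun v y hy => ?_) (fun x y hx hy => ?_)
        (frontOp_mem_tens (R := R) (q := q) j hw)
      · rw [shift_ι_mul, contr_moveOp_mul ξ hat]
        exact splitAntisym_contr_moveOp_eq_zero hR h hat h0 ξ v hy
      · simp only [map_add, mul_add, hx, hy, add_zero]
    rw [h1, h3, map_zero, smul_zero, add_zero, contr_mul ξ hat] at h2
    exact (smul_eq_zero.mp h2.symm).resolve_left (pow_ne_zero _ hR.ne_zero)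

/-! ### Dimension count: the antisymmetrizers map onto Υ -/

theorem upsilon_eq_bot [FiniteDimensional k V] {n m : ℕ} (hvan : upsilon R q (n + 1) = ⊥)
    (h : n < m) : upsilon R q m = ⊥ := by
  induction m, h using Nat.le_induction with
  | base => exact hvan
  | succ m _ ih =>
    rw [eq_bot_iff]
    intro x hx
    refine (Submodule.mem_bot k).mpr (eq_of_contr_eq (upsilon_le_tens _ hx) (zero_mem _) fun ξ => ?_)
    have := contr_mem_upsilon ξ hx
    rw [ih, Submodule.mem_bot] at this
    rw [this, map_zero]

instance [FiniteDimensional k V] (n : ℕ) : FiniteDimensional k (tens k V n) :=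
  Module.Finite.iff_fg.mpr (Submodule.FG.pow (Module.Finite.iff_fg.mp inferInstance) n)

instance [FiniteDimensional k V] (n : ℕ) : FiniteDimensional k (upsilon R q n) :=
  Submodule.finiteDimensional_of_le (upsilon_le_tens n)

/-- As Υ^{(n)} is a line, ⋆ is a scalar pairing without left radical and embeds Υ^{(i)} into the
dual of y_j V^{⊗j}. -/
theorem finrank_upsilon_le (hR : IsHeckeSymmetry R q) [FiniteDimensional k V]
    {n : ℕ} (hdim : Module.finrank k (upsilon R q n) = 1)
    (hvan : upsilon R q (n + 1) = ⊥) (hy : (tens k V n).map (antisym R q n) ≠ ⊥)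
    {i j : ℕ} (h : i + j = n) : Module.finrank k (upsilon R q i) ≤
      Module.finrank k ((tens k V j).map (antisym R q j)) := by
  have hB : ∀ m, (tens k V m).map (antisym R q m) ≤ upsilon R q m := by
    rintro m _ ⟨x, hx, rfl⟩
    exact antisym_mem_upsilon hR hx
  obtain ⟨χ⟩ : Nonempty (upsilon R q n ≃ₗ[k] k) :=
    FiniteDimensional.nonempty_linearEquiv_of_finrank_eq (by rw [hdim, Module.finrank_self])
  let F : upsilon R q i →ₗ[k] Module.Dual k ((tens k V j).map (antisym R q j)) :=
    LinearMap.mk₂ k (fun a b => χ ⟨splitAntisym R q n i (a * b),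
        splitAntisym_mul_mem_upsilon hR h a.2 (hB j b.2)⟩)
      (fun a a' b => by rw [← map_add]; congr 1; ext; simp [add_mul])
      (fun c a b => by rw [← map_smul]; congr 1; ext; simp)
      (fun a b b' => by rw [← map_add]; congr 1; ext; simp [mul_add])
      (fun c a b => by rw [← map_smul]; congr 1; ext; simp)
  have hF : Function.Injective F := by
    rw [injective_iff_map_eq_zero]
    intro a ha
    ext1
    refine eq_zero_of_splitAntisym_eq_zero hR hvan hy h a.2 fun w hw => ?_
    have h1 : χ _ = 0 := LinearMap.congr_fun ha ⟨antisym R q j w, w, hw, rfl⟩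
    rw [map_eq_zero_iff _ χ.injective] at h1
    exact congrArg Subtype.val h1
  have := LinearMap.finrank_le_finrank_of_injective hF
  rwa [Subspace.dual_finrank_eq] at this

theorem map_antisym_eq_upsilon (hR : IsHeckeSymmetry R q) [FiniteDimensional k V]
    {n : ℕ} (hdim : Module.finrank k (upsilon R q n) = 1)
    (hvan : upsilon R q (n + 1) = ⊥) (hy : (tens k V n).map (antisym R q n) ≠ ⊥) (i : ℕ) :
    (tens k V i).map (antisym R q i) = upsilon R q i := by
  have hB : ∀ m, (tens k V m).map (antisym R q m) ≤ upsilon R q m := by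
    rintro m _ ⟨x, hx, rfl⟩
    exact antisym_mem_upsilon hR hx
  obtain h | h := lt_or_ge n i
  · have := hB i
    rw [upsilon_eq_bot hvan h] at this ⊢
    exact eq_bot_iff.mpr this
  · obtain ⟨j, rfl⟩ := Nat.exists_eq_add_of_le h
    -- The inequality for (i, j), the inclusion y_j V^{⊗j} ⊆ Υ^{(j)} and the inequality for (j, i)
    -- close up into a cycle.
    refine Submodule.eq_of_le_of_finrank_le (hB i) ?_
    exact ((finrank_upsilon_le hR hdim hvan hy rfl).trans (Submodule.finrank_mono (hB j))).trans
      (finrank_upsilon_le hR hdim hvan hy (add_comm j i))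

end

section

/-! ### The homomorphism `T(V) → Υ(V,R)` -/

section totalAntisym

variable (R : V ⊗[k] V →ₗ[k] V ⊗[k] V) (q : k)

/-- The linear operator on `T(V)` which acts on `T_m(V)` as the antisymmetrizer `y_m`. -/
def totalAntisym : Module.End k (TensorAlgebra k V) :=
  (DirectSum.toModule k ℕ (TensorAlgebra k V) fun i =>
    (antisym R q i).domRestrict (tens k V i)) ∘ₗ
    (DirectSum.decomposeLinearEquiv (tens k V)).toLinearMap

variable {R q}

theorem totalAntisym_apply {m : ℕ} {x : TensorAlgebra k V} (hx : x ∈ tens k V m) :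
    totalAntisym R q x = antisym R q m x := by
  simp only [totalAntisym, LinearMap.comp_apply, LinearEquiv.coe_coe,
    DirectSum.decomposeLinearEquiv_apply, DirectSum.decompose_of_mem _ hx]
  rw [← DirectSum.lof_eq_of k, DirectSum.toModule_lof]
  rfl

theorem decompose_totalAntisym (x : TensorAlgebra k V) (m : ℕ) :
    (DirectSum.decompose (tens k V) (totalAntisym R q x) m : TensorAlgebra k V) =
      antisym R q m (DirectSum.decompose (tens k V) x m : TensorAlgebra k V) := by
  induction x using DirectSum.Decomposition.inductionOn (tens k V) with
  | zero => simp
  | @homogeneous i x =>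
    have hx := antisym_mem_tens (R := R) (q := q) i x.2
    rw [totalAntisym_apply x.2]
    by_cases h : i = m
    · subst h
      rw [DirectSum.decompose_of_mem_same _ hx, DirectSum.decompose_of_mem_same _ x.2]
    · rw [DirectSum.decompose_of_mem_ne _ hx h, DirectSum.decompose_of_mem_ne _ x.2 h, map_zero]
  | add x y hx hy => simp [hx, hy]

theorem totalAntisym_eq_zero_iff {x : TensorAlgebra k V} :
    totalAntisym R q x = 0 ↔
      ∀ m, antisym R q m (DirectSum.decompose (tens k V) x m : TensorAlgebra k V) = 0 := by
  simp only [← decompose_totalAntisym]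
  constructor
  · intro h m
    simp [h]
  · intro h
    apply (DirectSum.decompose (tens k V)).injective
    rw [DirectSum.decompose_zero]
    ext m
    simpa using h m

theorem starMul_eq {i j n : ℕ} (h : i + j = n) {a b : TensorAlgebra k V}
    (ha : a ∈ tens k V i) (hb : b ∈ tens k V j) :
    starMul R q a b = splitAntisym R q n i (a * b) := by
  rw [starMul_apply R q ha hb, shuffleAntisym_eq, h]

theorem frontOp_zero : frontOp R q 0 = 1 := by simp [frontOp, moveOp]

theorem antisym_one_apply [FiniteDimensional k V] (hR : IsHeckeSymmetry R q)
    {x : TensorAlgebra k V} (hx : x ∈ tens k V 1) : antisym R q 1 x = x := by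
  have hx' : x ∈ tens k V (0 + 1) := hx
  rw [antisym_succ_apply hR hx', frontOp_zero, antisym_zero, Module.End.one_apply,
    shift_one_apply hx']

theorem antisym_two_apply [FiniteDimensional k V] (hR : IsHeckeSymmetry R q)
    {x : TensorAlgebra k V} (hx : x ∈ tens k V 2) : antisym R q 2 x = q • x - act R 0 x := by
  have hx' : x ∈ tens k V (1 + 1) := hx
  have h : frontOp R q 1 x = q • x - act R 0 x := by
    simp [frontOp, moveOp, Finset.sum_range_succ, sub_eq_add_neg]
  have hy : q • x - act R 0 x ∈ tens k V (1 + 1) :=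
    sub_mem (Submodule.smul_mem _ _ hx') (act_mem_tens R 0 _ hx')
  rw [antisym_succ_apply hR hx', h, shift_congr (fun y hy => antisym_one_apply hR hy) hy
    (Y := 1), shift_one_apply hy]

theorem antisym_glueTwo [FiniteDimensional k V] (hR : IsHeckeSymmetry R q) (z : V ⊗[k] V) :
    antisym R q 2 (glueTwo k V z) = - glueTwo k V
      ((R - q • LinearMap.id : V ⊗[k] V →ₗ[k] V ⊗[k] V) z) := by
  have := act_zero_glueTwo_mul R z 1
  rw [mul_one, mul_one] at this
  rw [antisym_two_apply hR (glueTwo_mem_tens z), this]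
  simp

theorem totalAntisym_one : totalAntisym R q 1 = 1 := by
  rw [totalAntisym_apply one_mem_tens, antisym_zero, Module.End.one_apply]

theorem skewIdeal_le_iff {J : Ideal (TensorAlgebra k V)} [J.IsTwoSided] :
    skewIdeal R q ≤ J ↔ ∀ z, (R - q • LinearMap.id : V ⊗[k] V →ₗ[k] V ⊗[k] V) z = 0 →
      glueTwo k V z ∈ J := by
  rw [skewIdeal]
  conv_lhs => rw [← Ideal.asIdeal_toTwoSided J]
  have h : (TwoSidedIdeal.span (glueTwo k V ''
      (LinearMap.ker (R - q • LinearMap.id) : Set (V ⊗[k] V)))).asIdeal ≤ J.toTwoSided.asIdeal ↔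
      TwoSidedIdeal.span (glueTwo k V ''
      (LinearMap.ker (R - q • LinearMap.id) : Set (V ⊗[k] V))) ≤ J.toTwoSided := Iff.rfl
  rw [h, TwoSidedIdeal.span_le, Set.image_subset_iff]
  simp [Set.subset_def]

instance : (skewIdeal R q).IsTwoSided := by rw [skewIdeal]; infer_instance

theorem glueTwo_mem_skewIdeal {z : V ⊗[k] V}
    (h : (R - q • LinearMap.id : V ⊗[k] V →ₗ[k] V ⊗[k] V) z = 0) :
    glueTwo k V z ∈ skewIdeal R q := skewIdeal_le_iff.mp le_rfl z h

variable [FiniteDimensional k V]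

theorem totalAntisym_mul (hR : IsHeckeSymmetry R q) (u w : TensorAlgebra k V) :
    totalAntisym R q (u * w) = starMul R q (totalAntisym R q u) (totalAntisym R q w) := by
  induction u using DirectSum.Decomposition.inductionOn (tens k V) with
  | zero => simp
  | add x y hx hy => simp only [add_mul, map_add, LinearMap.add_apply, hx, hy]
  | homogeneous u =>
  induction w using DirectSum.Decomposition.inductionOn (tens k V) with
  | zero => simp
  | add x y hx hy => simp only [mul_add, map_add, hx, hy]
  | homogeneous w =>
  rw [totalAntisym_apply u.2, totalAntisym_apply w.2, starMul_eq rfl (antisym_mem_tens _ u.2)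
    (antisym_mem_tens _ w.2), totalAntisym_apply (mul_mem_tens rfl u.2 w.2),
    antisym_mul hR rfl u.2 w.2]

theorem totalAntisym_ι (hR : IsHeckeSymmetry R q) (v : V) :
    totalAntisym R q (TensorAlgebra.ι k v) = TensorAlgebra.ι k v := by
  rw [totalAntisym_apply (ι_mem_tens v), antisym_one_apply hR (ι_mem_tens v)]

theorem totalAntisym_mem_upsilon (hR : IsHeckeSymmetry R q) {i : ℕ} {x : TensorAlgebra k V}
    (hx : x ∈ tens k V i) : totalAntisym R q x ∈ upsilon R q i := by
  rw [totalAntisym_apply hx]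
  exact antisym_mem_upsilon hR hx

theorem totalAntisym_mem_Upsilon (hR : IsHeckeSymmetry R q) (x : TensorAlgebra k V) :
    totalAntisym R q x ∈ Upsilon R q := by
  induction x using DirectSum.Decomposition.inductionOn (tens k V) with
  | zero => simp
  | homogeneous x => exact Submodule.mem_iSup_of_mem _ (totalAntisym_mem_upsilon hR x.2)
  | add x y hx hy => rw [map_add]; exact add_mem hx hy

/-- The kernel of the homomorphism `T(V) → Υ(V,R)`. -/
def antisymIdeal (hR : IsHeckeSymmetry R q) : Ideal (TensorAlgebra k V) where
  carrier := {x | totalAntisym R q x = 0}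
  add_mem' {x y} hx hy := by
    change totalAntisym R q (x + y) = 0
    rw [map_add, show totalAntisym R q x = 0 from hx, show totalAntisym R q y = 0 from hy,
      add_zero]
  zero_mem' := map_zero _
  smul_mem' r x hx := by
    change totalAntisym R q (r * x) = 0
    rw [totalAntisym_mul hR, show totalAntisym R q x = 0 from hx, map_zero]

theorem mem_antisymIdeal {hR : IsHeckeSymmetry R q} {x : TensorAlgebra k V} :
    x ∈ antisymIdeal hR ↔ totalAntisym R q x = 0 := Iff.rfl

instance (hR : IsHeckeSymmetry R q) : (antisymIdeal hR).IsTwoSided :=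
  ⟨fun b ha => by
    rw [mem_antisymIdeal] at *
    rw [totalAntisym_mul hR, ha, map_zero, LinearMap.zero_apply]⟩

theorem antisymIdeal_isHomogeneous (hR : IsHeckeSymmetry R q) :
    (antisymIdeal hR).IsHomogeneous (tens k V) := by
  intro i x hx
  rw [mem_antisymIdeal] at hx ⊢
  rw [totalAntisym_apply (SetLike.coe_mem _)]
  exact totalAntisym_eq_zero_iff.mp hx i

theorem skewIdeal_le_antisymIdeal (hR : IsHeckeSymmetry R q) :
    skewIdeal R q ≤ antisymIdeal hR := by
  rw [skewIdeal_le_iff]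
  intro z hz
  rw [mem_antisymIdeal, totalAntisym_apply (glueTwo_mem_tens z), antisym_glueTwo hR, hz, map_zero,
    neg_zero]

/-- Since y_2 = q - R, the degree 2 part of the kernel ideal is just the space of generators of I,
while I lies inside that ideal. -/
theorem mem_skewIdeal_of_mem_tens_two (hR : IsHeckeSymmetry R q) {x : TensorAlgebra k V}
    (hx : x ∈ tens k V 2) : x ∈ skewIdeal R q ↔ antisym R q 2 x = 0 := by
  constructor
  · intro h
    have := skewIdeal_le_antisymIdeal hR h
    rwa [mem_antisymIdeal, totalAntisym_apply hx] at this
  · intro h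
    obtain ⟨z, rfl⟩ := mem_tens_two hx
    rw [antisym_glueTwo hR, neg_eq_zero, map_eq_zero_iff _ glueTwo_injective] at h
    exact glueTwo_mem_skewIdeal h

end totalAntisym

/-! ### The `q`-factorial and the ideal `I` -/

section skewIdeal

variable {R : V ⊗[k] V →ₗ[k] V ⊗[k] V} {q : k}

/-- The image of R + Id lies in Ker(R - q Id) by the Hecke relation, so T_s acts as -1 modulo I. -/
theorem act_add_mem_skewIdeal (hR : IsHeckeSymmetry R q) {s m : ℕ} (h : s + 2 ≤ m)
    {x : TensorAlgebra k V} (hx : x ∈ tens k V m) : act R s x + x ∈ skewIdeal R q := by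
  obtain ⟨d, rfl⟩ := Nat.exists_eq_add_of_le h
  rw [show s + 2 + d = s + (d + 2) by ring] at hx
  refine tens_mul_induction (fun a ha y hy => ?_) (fun x y hx hy => ?_) hx
  · refine tens_two_induction (fun z b hb => ?_) (fun x y hx hy => ?_) hy
    · rw [act_apply R s ha, ← mul_add, ← add_mul, ← map_add]
      refine Ideal.mul_mem_left _ _ (Ideal.mul_mem_right _ _ (glueTwo_mem_skewIdeal ?_))
      exact LinearMap.congr_fun hR.hecke z
    · rw [mul_add, map_add, add_add_add_comm]; exact add_mem hx hy
  · rw [map_add, add_add_add_comm]; exact add_mem hx hy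

theorem smul_mem_skewIdeal (c : k) {x : TensorAlgebra k V} (hx : x ∈ skewIdeal R q) :
    c • x ∈ skewIdeal R q := by
  rw [Algebra.smul_def]
  exact Ideal.mul_mem_left _ _ hx

theorem moveOp_sub_mem_skewIdeal (hR : IsHeckeSymmetry R q) {p m : ℕ} (h : p + 1 ≤ m)
    {x : TensorAlgebra k V} (hx : x ∈ tens k V m) :
    moveOp R p x - (-1 : k) ^ p • x ∈ skewIdeal R q := by
  induction p generalizing x with
  | zero => simp [moveOp]
  | succ p ih =>
    have h1 := ih (by omega) (act_mem_tens R p m hx)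
    have h2 := smul_mem_skewIdeal ((-1 : k) ^ p) (act_add_mem_skewIdeal hR (by omega : p + 2 ≤ m) hx)
    have := add_mem h1 h2
    convert this using 1
    rw [moveOp, Module.End.mul_apply]
    module

theorem qFactorial_succ (q : k) (m : ℕ) :
    qFactorial q (m + 1) = qFactorial q m * ∑ i ∈ Finset.range (m + 1), q ^ i :=
  Finset.prod_Icc_succ_top (by omega) _

theorem frontOp_sub_mem_skewIdeal (hR : IsHeckeSymmetry R q) {m : ℕ}
    {x : TensorAlgebra k V} (hx : x ∈ tens k V (m + 1)) :
    frontOp R q m x - (∑ i ∈ Finset.range (m + 1), q ^ i) • x ∈ skewIdeal R q := by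
  have h1 : ∑ i ∈ Finset.range (m + 1), q ^ i = ∑ p ∈ Finset.range (m + 1), q ^ (m - p) := by
    rw [← Finset.sum_range_reflect]
    rfl
  rw [h1, frontOp, LinearMap.sum_apply, Finset.sum_smul, ← Finset.sum_sub_distrib]
  refine Ideal.sum_mem _ fun p hp => ?_
  have hp' := Finset.mem_range.mp hp
  have := smul_mem_skewIdeal ((-1 : k) ^ p * q ^ (m - p))
    (moveOp_sub_mem_skewIdeal hR (by omega : p + 1 ≤ m + 1) hx)
  convert this using 1
  rw [LinearMap.smul_apply, smul_sub, smul_smul, mul_right_comm, ← mul_pow]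
  simp

/-- With T_s ≡ -1 the signs cancel: `frontOp` becomes 1 + q + ⋯ + q^m, and the recursion for y_{m+1}
multiplies these numbers up. -/
theorem antisym_sub_mem_skewIdeal [FiniteDimensional k V] (hR : IsHeckeSymmetry R q) {m : ℕ}
    {x : TensorAlgebra k V} (hx : x ∈ tens k V m) :
    antisym R q m x - qFactorial q m • x ∈ skewIdeal R q := by
  induction m generalizing x with
  | zero => simp [antisym_zero, qFactorial]
  | succ m ih =>
    have h1 : ∀ y ∈ tens k V (m + 1),
        shift (antisym R q m) y - qFactorial q m • y ∈ skewIdeal R q := by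
      intro y hy
      refine tens_succ_induction (fun v y hy => ?_) (fun x y hx hy => ?_) hy
      · rw [shift_ι_mul, ← mul_smul_comm, ← mul_sub]
        exact Ideal.mul_mem_left _ _ (ih hy)
      · rw [map_add, smul_add, add_sub_add_comm]; exact add_mem hx hy
    have h2 := add_mem (h1 _ (frontOp_mem_tens (R := R) (q := q) m hx))
      (smul_mem_skewIdeal (qFactorial q m) (frontOp_sub_mem_skewIdeal hR hx))
    rw [antisym_succ_apply hR hx, qFactorial_succ, mul_smul]
    convert h2 using 1
    module

theorem mem_skewIdeal_of_antisym_eq_zero [FiniteDimensional k V] (hR : IsHeckeSymmetry R q)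
    {m n : ℕ} (hmn : m ≤ n) (hq : qFactorial q n ≠ 0) {x : TensorAlgebra k V}
    (hx : x ∈ tens k V m) (h : antisym R q m x = 0) : x ∈ skewIdeal R q := by
  have hm : qFactorial q m ≠ 0 := by
    rw [qFactorial, Finset.prod_ne_zero_iff] at hq ⊢
    intro i hi
    exact hq i (Finset.Icc_subset_Icc le_rfl hmn hi)
  have h1 := antisym_sub_mem_skewIdeal hR hx
  rw [h, zero_sub, ← smul_neg] at h1
  have h2 := smul_mem_skewIdeal (qFactorial q m)⁻¹ h1
  rw [inv_smul_smul₀ hm] at h2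
  exact neg_mem_iff.mp h2

/-- If `V` is spanned by one vector then `R` is scalar, and the vanishing of `Υ^{(n+1)}` forces
`T_{n+1}(V) ⊆ I`. -/
theorem tens_le_skewIdeal_of_forall_eq_smul {n : ℕ} (hn : 0 < n)
    (hvan : upsilon R q (n + 1) = ⊥) {p : V} (hp : ∀ v, ∃ c : k, v = c • p)
    {x : TensorAlgebra k V} (hx : x ∈ tens k V (n + 1)) : x ∈ skewIdeal R q := by
  have hz : ∀ z : V ⊗[k] V, ∃ c : k, z = c • (p ⊗ₜ p) := by
    intro z
    induction z using TensorProduct.induction_on with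
    | zero => exact ⟨0, by simp⟩
    | tmul v w =>
      obtain ⟨c, rfl⟩ := hp v
      obtain ⟨d, rfl⟩ := hp w
      exact ⟨c * d, by rw [TensorProduct.smul_tmul_smul]⟩
    | add x y hx hy =>
      obtain ⟨c, rfl⟩ := hx
      obtain ⟨d, rfl⟩ := hy
      exact ⟨c + d, (add_smul _ _ _).symm⟩
  obtain ⟨r, hr⟩ := hz (R (p ⊗ₜ p))
  have hRz : ∀ z, R z = r • z := by
    intro z
    obtain ⟨c, rfl⟩ := hz z
    rw [map_smul, hr, smul_comm]
  -- If r = q then all of T_2(V) lies in I. Otherwise every T_s - q is an invertible scalar on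
  -- T_{n+1}(V), so this space equals Υ^{(n+1)} = 0.
  by_cases hrq : r = q
  · obtain ⟨m, rfl⟩ := Nat.exists_eq_add_of_le' hn
    refine tens_two_induction (fun z y hy => ?_) (fun x y hx hy => add_mem hx hy) hx
    refine Ideal.mul_mem_right _ _ (glueTwo_mem_skewIdeal ?_)
    simp [hRz, hrq]
  · suffices x ∈ upsilon R q (n + 1) by
      rw [hvan, Submodule.mem_bot] at this
      rw [this]
      exact zero_mem _
    rw [mem_upsilon_iff]
    refine ⟨hx, fun s hs => ⟨(r - q)⁻¹ • x, Submodule.smul_mem _ _ hx, ?_⟩⟩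
    have hact : act R s x = r • x := by
      obtain ⟨d, hd⟩ := Nat.exists_eq_add_of_le hs
      rw [show n + 1 = s + (d + 2) by omega] at hx
      refine tens_mul_induction (fun a ha y hy => ?_) (fun x y hx hy => ?_) hx
      · refine tens_two_induction (fun z b hb => ?_) (fun x y hx hy => ?_) hy
        · rw [act_apply R s ha, hRz, map_smul, smul_mul_assoc, mul_smul_comm]
        · rw [mul_add, map_add, hx, hy, smul_add]
      · rw [map_add, hx, hy, smul_add]
    rw [map_smul, hact, smul_comm q, ← smul_sub, ← sub_smul, inv_smul_smul₀ (sub_ne_zero.mpr hrq)]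

/-- Let `F` be a linear function on `T_n(V)` with kernel `Ker y_n` which is twisted cyclic. If
`Υ^{(n+1)} = 0` and `[n]!_q ≠ 0`, then `T_{n+1}(V) ⊆ I`. -/
theorem tens_succ_le_skewIdeal [FiniteDimensional k V] (hR : IsHeckeSymmetry R q) {n : ℕ}
    (hvan : upsilon R q (n + 1 + 1) = ⊥) (hq : qFactorial q (n + 1) ≠ 0)
    (hy : (tens k V (n + 1)).map (antisym R q (n + 1)) ≠ ⊥)
    (F : TensorAlgebra k V →ₗ[k] k)
    (hF : ∀ x ∈ tens k V (n + 1), F x = 0 ↔ antisym R q (n + 1) x = 0)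
    (htw : ∀ v : V, ∃ p : V, ∀ w ∈ tens k V n,
      F (w * TensorAlgebra.ι k v) = F (TensorAlgebra.ι k p * w))
    (hrad : ∀ v : V, (∀ w ∈ tens k V n, F (TensorAlgebra.ι k v * w) = 0) → v = 0)
    {x : TensorAlgebra k V} (hx : x ∈ tens k V (n + 1 + 1)) : x ∈ skewIdeal R q := by
  obtain ⟨ω, hω, hFω⟩ : ∃ ω ∈ tens k V (n + 1), F ω = 1 := by
    obtain ⟨_, ⟨z, hz, rfl⟩, hne⟩ := Submodule.exists_mem_ne_zero_of_ne_bot hy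
    have hFz : F z ≠ 0 := mt (hF z hz).mp hne
    exact ⟨(F z)⁻¹ • z, Submodule.smul_mem _ _ hz, by simp [hFz]⟩
  -- Modulo I the top component is spanned by ω, with F as coordinate. The top degree is n + 1 here.
  have hred : ∀ u ∈ tens k V (n + 1), u - F u • ω ∈ skewIdeal R q := by
    intro u hu
    have hmem : u - F u • ω ∈ tens k V (n + 1) := sub_mem hu (Submodule.smul_mem _ _ hω)
    refine mem_skewIdeal_of_antisym_eq_zero hR le_rfl hq hmem ((hF _ hmem).mp ?_)
    simp [hFω]
  by_cases hall : ∀ v, ω * TensorAlgebra.ι k v ∈ skewIdeal R q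
  · refine tens_mul_induction (fun u hu y hy => ?_) (fun x y hx hy => add_mem hx hy) hx
    obtain ⟨v, rfl⟩ := mem_tens_one hy
    have h1 := Ideal.mul_mem_right (TensorAlgebra.ι k v) _ (hred u hu)
    have h2 := smul_mem_skewIdeal (F u) (hall v)
    have := add_mem h1 h2
    rwa [sub_mul, smul_mul_assoc, sub_add_cancel] at this
  · push Not at hall
    obtain ⟨v', hv'⟩ := hall
    obtain ⟨p, hp⟩ := htw v'
    refine tens_le_skewIdeal_of_forall_eq_smul (Nat.succ_pos n) hvan (p := p) (fun v => ?_) hx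
    let L : V → (tens k V n →ₗ[k] k) := fun v =>
      F ∘ₗ LinearMap.mulLeft k (TensorAlgebra.ι k v) ∘ₗ (tens k V n).subtype
    -- Modulo I, (vw)v' ≡ F(vw) ωv' and v(wv') ≡ F(wv') vω = F(pw) vω. If F(pw) = 0 then F(vw) ωv' ∈
    -- I, and ωv' ∉ I forces F(vw) = 0. So the functions F(v ·) are all multiples of F(p ·), and
    -- nondegeneracy makes v a multiple of p.
    have hker : ∀ w : tens k V n, L p w = 0 → L v w = 0 := by
      intro w hw
      have hpw : F (w * TensorAlgebra.ι k v') = 0 := by rw [hp _ w.2]; exact hw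
      have hvw : TensorAlgebra.ι k v * (w : TensorAlgebra k V) ∈ tens k V (n + 1) :=
        ι_mul_mem_tens v w.2
      have hwv : (w : TensorAlgebra k V) * TensorAlgebra.ι k v' ∈ tens k V (n + 1) :=
        mul_mem_tens rfl w.2 (ι_mem_tens v')
      have h1 := Ideal.mul_mem_right (TensorAlgebra.ι k v') _ (hred _ hvw)
      have h2 := Ideal.mul_mem_left _ (TensorAlgebra.ι k v) (hred _ hwv)
      rw [hpw, zero_smul, sub_zero, ← mul_assoc] at h2
      have h3 := sub_mem h2 h1
      rw [sub_mul, sub_sub_cancel, smul_mul_assoc] at h3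
      by_contra hne
      change F (TensorAlgebra.ι k v * (w : TensorAlgebra k V)) ≠ 0 at hne
      have h4 := smul_mem_skewIdeal (F (TensorAlgebra.ι k v * (w : TensorAlgebra k V)))⁻¹ h3
      rw [inv_smul_smul₀ hne] at h4
      exact hv' h4
    have hspan := mem_span_of_iInf_ker_le_ker (L := fun _ : Unit => L p) (K := L v) (by
      intro w hw
      simp only [ciInf_const, LinearMap.mem_ker] at hw ⊢
      exact hker w hw)
    rw [Set.range_const, Submodule.mem_span_singleton] at hspan
    obtain ⟨c, hc⟩ := hspan
    refine ⟨c, ?_⟩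
    rw [← sub_eq_zero]
    refine hrad _ fun w hw => ?_
    have := LinearMap.congr_fun hc ⟨w, hw⟩
    simp only [L, LinearMap.smul_apply, LinearMap.comp_apply, Submodule.subtype_apply,
      LinearMap.mulLeft_apply] at this
    rw [map_sub, sub_mul, map_sub, map_smul, smul_mul_assoc, map_smul, this, sub_self]

end skewIdeal

/-! ### Nakayama automorphisms of Frobenius algebras -/

theorem separatingRight_of_separatingLeft {A : Type*} [Ring A] [Algebra k A]
    [FiniteDimensional k A] {l : A →ₗ[k] k} (h : ∀ x, (∀ y, l (x * y) = 0) → x = 0) (y : A)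
    (hy : ∀ x, l (x * y) = 0) : y = 0 := by
  let B : A →ₗ[k] Module.Dual k A := (LinearMap.mul k A).compr₂ l
  have hB : Function.Injective B := by
    rw [injective_iff_map_eq_zero]
    exact fun x hx => h x fun y => LinearMap.congr_fun hx y
  let e := B.linearEquivOfInjective hB Subspace.dual_finrank_eq.symm
  rw [← Module.forall_dual_apply_eq_zero_iff k]
  intro φ
  obtain ⟨x, rfl⟩ := e.surjective φ
  exact hy x

/-- Both a ↦ l(· a) and a ↦ l(a ·) are isomorphisms onto the dual, and ν compares them.
Multiplicativity follows from l(baa') = l(ν(a')ba) = l(ν(a)ν(a')b). -/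
theorem exists_nakayama {A : Type*} [Ring A] [Algebra k A] [FiniteDimensional k A]
    {l : A →ₗ[k] k} (h : ∀ x, (∀ y, l (x * y) = 0) → x = 0) :
    ∃ ν : A ≃ₗ[k] A, (∀ a b, l (b * a) = l (ν a * b)) ∧ ν 1 = 1 ∧
      ∀ a b, ν (a * b) = ν a * ν b := by
  let B : A →ₗ[k] Module.Dual k A := (LinearMap.mul k A).compr₂ l
  have hB : Function.Injective B := by
    rw [injective_iff_map_eq_zero]
    exact fun x hx => h x fun y => LinearMap.congr_fun hx y
  have hB' : Function.Injective B.flip := by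
    rw [injective_iff_map_eq_zero]
    exact fun x hx => separatingRight_of_separatingLeft h x fun y => LinearMap.congr_fun hx y
  let e := B.linearEquivOfInjective hB Subspace.dual_finrank_eq.symm
  let e' := B.flip.linearEquivOfInjective hB' Subspace.dual_finrank_eq.symm
  have hν : ∀ a b, l (b * a) = l ((e' ≪≫ₗ e.symm) a * b) := by
    intro a b
    have h1 : e ((e' ≪≫ₗ e.symm) a) = e' a := by simp
    exact (LinearMap.congr_fun h1 b).symm
  have huniq : ∀ x y, (∀ b, l (x * b) = l (y * b)) → x = y := fun x y hxy => by
    rw [← sub_eq_zero]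
    exact h _ fun b => by rw [sub_mul, map_sub, hxy, sub_self]
  refine ⟨e' ≪≫ₗ e.symm, hν, huniq _ _ fun b => ?_, fun a a' => huniq _ _ fun b => ?_⟩
  · rw [← hν, mul_one, one_mul]
  · rw [← hν, mul_assoc, ← hν, mul_assoc, ← hν, mul_assoc]

end

section

variable {R : V ⊗[k] V →ₗ[k] V ⊗[k] V} {q : k}

/-! ### The quotient `T(V)/I'` -/

/-- The extension of a linear function on `T_n(V)` by zero to `T(V)`. -/
def extendByZero {n : ℕ} (f : tens k V n →ₗ[k] k) : TensorAlgebra k V →ₗ[k] k :=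
  f ∘ₗ DirectSum.component k ℕ (fun i => tens k V i) n ∘ₗ
    (DirectSum.decomposeLinearEquiv (tens k V)).toLinearMap

theorem extendByZero_eq {n : ℕ} (f : tens k V n →ₗ[k] k) (x : TensorAlgebra k V) :
    extendByZero f x = f (DirectSum.decompose (tens k V) x n) := rfl

theorem extendByZero_of_mem {n : ℕ} (f : tens k V n →ₗ[k] k) {x : TensorAlgebra k V}
    (hx : x ∈ tens k V n) : extendByZero f x = f ⟨x, hx⟩ := by
  rw [extendByZero_eq]
  congr 1
  exact Subtype.ext (DirectSum.decompose_of_mem_same _ hx)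

theorem extendByZero_of_mem_ne {m n : ℕ} (f : tens k V n →ₗ[k] k) {x : TensorAlgebra k V}
    (hx : x ∈ tens k V m) (h : m ≠ n) : extendByZero f x = 0 := by
  rw [extendByZero_eq]
  have : DirectSum.decompose (tens k V) x n = 0 :=
    Subtype.ext (DirectSum.decompose_of_mem_ne _ hx h)
  rw [this, map_zero]

theorem extendByZero_mul {i j n : ℕ} (h : i + j = n) (f : tens k V n →ₗ[k] k)
    (z : TensorAlgebra k V) {w : TensorAlgebra k V} (hw : w ∈ tens k V j) :
    extendByZero f (z * w) =
      extendByZero f ((DirectSum.decompose (tens k V) z i : TensorAlgebra k V) * w) := by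
  obtain rfl : i = n - j := by omega
  have h1 : (DirectSum.decompose (tens k V) z (n - j) : TensorAlgebra k V) * w ∈ tens k V n :=
    mul_mem_tens h (SetLike.coe_mem _) hw
  rw [extendByZero_eq, extendByZero_of_mem f h1]
  congr 1
  ext
  change (DirectSum.decompose (tens k V) (z * w) n : TensorAlgebra k V) = _
  rw [DirectSum.coe_decompose_mul_of_right_mem_of_le _ hw (by omega)]

theorem mem_radical_iff {n : ℕ} {f : tens k V n →ₗ[k] k} {i : ℕ} {u : TensorAlgebra k V} :
    u ∈ radical f i ↔ u ∈ tens k V i ∧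
      ∀ j, i + j = n → ∀ w ∈ tens k V j, extendByZero f (u * w) = 0 := by
  constructor
  · rintro ⟨hu, h⟩
    exact ⟨hu, fun j hj w hw => by
      rw [extendByZero_of_mem f (mul_mem_tens hj hu hw)]; exact h j hj ⟨w, hw⟩⟩
  · rintro ⟨hu, h⟩
    exact ⟨hu, fun j hj w => by
      rw [← extendByZero_of_mem f (mul_mem_tens hj hu w.2)]; exact h j hj w w.2⟩

theorem extendByZero_eq_zero_iff {n : ℕ} {f : tens k V n →ₗ[k] k}
    (hf : LinearMap.ker f = LinearMap.ker ((antisym R q n).domRestrict (tens k V n)))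
    {x : TensorAlgebra k V} (hx : x ∈ tens k V n) :
    extendByZero f x = 0 ↔ antisym R q n x = 0 := by
  rw [extendByZero_of_mem f hx, ← LinearMap.mem_ker, hf, LinearMap.mem_ker]
  rfl

variable [FiniteDimensional k V]

/-- f(uw) = 0 means y_n(uw) = 0, that is y_i u ⋆ y_j w = 0; nondegeneracy then gives y_i u = 0. For
i > n both conditions are automatic because Υ^{(i)} = 0. -/
theorem mem_radical_iff_antisym (hR : IsHeckeSymmetry R q) {n : ℕ}
    (hvan : upsilon R q (n + 1) = ⊥) (hy : (tens k V n).map (antisym R q n) ≠ ⊥)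
    {f : tens k V n →ₗ[k] k}
    (hf : LinearMap.ker f = LinearMap.ker ((antisym R q n).domRestrict (tens k V n)))
    {i : ℕ} {u : TensorAlgebra k V} :
    u ∈ radical f i ↔ u ∈ tens k V i ∧ antisym R q i u = 0 := by
  rw [mem_radical_iff]
  refine and_congr_right fun hu => ⟨fun h => ?_, fun h j hj w hw => ?_⟩
  · have hyu := antisym_mem_upsilon hR hu
    obtain hi | hi := lt_or_ge n i
    · rwa [upsilon_eq_bot hvan hi, Submodule.mem_bot] at hyu
    · obtain ⟨j, hj⟩ := Nat.exists_eq_add_of_le hi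
      refine eq_zero_of_splitAntisym_eq_zero hR hvan hy hj.symm hyu fun w hw => ?_
      rw [← antisym_mul hR hj.symm hu hw,
        ← extendByZero_eq_zero_iff hf (mul_mem_tens hj.symm hu hw)]
      exact h j hj.symm w hw
  · rw [extendByZero_eq_zero_iff hf (mul_mem_tens hj hu hw), antisym_mul hR hj hu hw, h, zero_mul,
      map_zero]

theorem mem_antisymIdeal_iff_radical (hR : IsHeckeSymmetry R q) {n : ℕ}
    (hvan : upsilon R q (n + 1) = ⊥) (hy : (tens k V n).map (antisym R q n) ≠ ⊥)
    {f : tens k V n →ₗ[k] k}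
    (hf : LinearMap.ker f = LinearMap.ker ((antisym R q n).domRestrict (tens k V n)))
    {x : TensorAlgebra k V} : x ∈ antisymIdeal hR ↔
      ∀ m, (DirectSum.decompose (tens k V) x m : TensorAlgebra k V) ∈ radical f m := by
  simp only [mem_antisymIdeal, totalAntisym_eq_zero_iff, mem_radical_iff_antisym hR hvan hy hf,
    SetLike.coe_mem, true_and]

theorem antisymIdeal_eq_radicalSum (hR : IsHeckeSymmetry R q) {n : ℕ}
    (hvan : upsilon R q (n + 1) = ⊥) (hy : (tens k V n).map (antisym R q n) ≠ ⊥)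
    {f : tens k V n →ₗ[k] k}
    (hf : LinearMap.ker f = LinearMap.ker ((antisym R q n).domRestrict (tens k V n))) :
    (antisymIdeal hR).restrictScalars k = radicalSum f := by
  apply le_antisymm
  · intro x hx
    rw [Submodule.restrictScalars_mem, mem_antisymIdeal_iff_radical hR hvan hy hf] at hx
    classical
    rw [← DirectSum.sum_support_decompose (tens k V) x]
    exact sum_mem fun m _ => Submodule.mem_iSup_of_mem m (hx m)
  · refine iSup_le fun i u hu => ?_
    obtain ⟨hu, h⟩ := (mem_radical_iff_antisym hR hvan hy hf).mp hu
    rw [Submodule.restrictScalars_mem, mem_antisymIdeal, totalAntisym_apply hu, h]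

theorem finiteDimensional_Upsilon {n : ℕ} (hvan : upsilon R q (n + 1) = ⊥) :
    FiniteDimensional k (Upsilon R q) := by
  have h : Upsilon R q = ⨆ i : Fin (n + 1), upsilon R q i := by
    apply le_antisymm
    · refine iSup_le fun i => ?_
      by_cases hi : i < n + 1
      · exact le_iSup (fun i : Fin (n + 1) => upsilon R q i) ⟨i, hi⟩
      · rw [upsilon_eq_bot hvan (by omega)]; exact bot_le
    · exact iSup_le fun i => le_iSup (upsilon R q) i
  rw [h]
  infer_instance

/-- The homomorphism `T(V) → Υ(V,R)`. -/
def toUpsilon (hR : IsHeckeSymmetry R q) : TensorAlgebra k V →ₗ[k] Upsilon R q :=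
  (totalAntisym R q).codRestrict _ (totalAntisym_mem_Upsilon hR)

theorem coe_toUpsilon (hR : IsHeckeSymmetry R q) (x : TensorAlgebra k V) :
    (toUpsilon hR x : TensorAlgebra k V) = totalAntisym R q x := rfl

theorem toUpsilon_surjective (hR : IsHeckeSymmetry R q)
    (h : ∀ i, (tens k V i).map (antisym R q i) = upsilon R q i) :
    Function.Surjective (toUpsilon hR) := by
  have key : Upsilon R q ≤ LinearMap.range (totalAntisym R q) := by
    refine iSup_le fun i => ?_
    rw [← h i]
    rintro _ ⟨x, hx, rfl⟩
    exact ⟨x, totalAntisym_apply hx⟩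
  rintro ⟨x, hx⟩
  obtain ⟨y, hy⟩ := key hx
  exact ⟨y, Subtype.ext hy⟩

/-- The isomorphism of `T(V)/I'` with `Υ(V,R)`. -/
def quotEquivUpsilon (hR : IsHeckeSymmetry R q)
    (h : ∀ i, (tens k V i).map (antisym R q i) = upsilon R q i) :
    (TensorAlgebra k V ⧸ antisymIdeal hR) ≃ₗ[k] Upsilon R q :=
  (Submodule.Quotient.restrictScalarsEquiv k (antisymIdeal hR)).symm ≪≫ₗ
    Submodule.quotEquivOfEq _ (LinearMap.ker (toUpsilon hR)) (by
      ext x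
      rw [Submodule.restrictScalars_mem, mem_antisymIdeal, LinearMap.mem_ker, ← coe_toUpsilon hR]
      exact Submodule.coe_eq_zero) ≪≫ₗ
    (toUpsilon hR).quotKerEquivOfSurjective (toUpsilon_surjective hR h)

theorem quotEquivUpsilon_mk (hR : IsHeckeSymmetry R q)
    (h : ∀ i, (tens k V i).map (antisym R q i) = upsilon R q i) (x : TensorAlgebra k V) :
    quotEquivUpsilon hR h (Ideal.Quotient.mk _ x) = toUpsilon hR x := rfl

theorem quotEquivUpsilon_mul (hR : IsHeckeSymmetry R q)
    (h : ∀ i, (tens k V i).map (antisym R q i) = upsilon R q i)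
    (a b : TensorAlgebra k V ⧸ antisymIdeal hR) :
    (quotEquivUpsilon hR h (a * b) : TensorAlgebra k V) =
      starMul R q (quotEquivUpsilon hR h a) (quotEquivUpsilon hR h b) := by
  obtain ⟨u, rfl⟩ := Ideal.Quotient.mk_surjective a
  obtain ⟨w, rfl⟩ := Ideal.Quotient.mk_surjective b
  rw [← map_mul, quotEquivUpsilon_mk, quotEquivUpsilon_mk, quotEquivUpsilon_mk]
  exact totalAntisym_mul hR u w

theorem quotEquivUpsilon_one (hR : IsHeckeSymmetry R q)
    (h : ∀ i, (tens k V i).map (antisym R q i) = upsilon R q i) :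
    quotEquivUpsilon hR h 1 = ⟨1, one_mem_Upsilon R q⟩ := by
  rw [← map_one (Ideal.Quotient.mk (antisymIdeal hR)), quotEquivUpsilon_mk]
  exact Subtype.ext totalAntisym_one

theorem isIsoUpsilon_quotEquivUpsilon (hR : IsHeckeSymmetry R q)
    (h : ∀ i, (tens k V i).map (antisym R q i) = upsilon R q i) :
    IsIsoUpsilon R q (antisymIdeal hR) (quotEquivUpsilon hR h) where
  map_one := by rw [quotEquivUpsilon_one]
  map_mul := quotEquivUpsilon_mul hR h
  map_degree _ _ hu := totalAntisym_mem_upsilon hR hu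

/-- The linear function on `T(V)/I'` induced by `f`. -/
def quotFun (hR : IsHeckeSymmetry R q) {n : ℕ} (f : tens k V n →ₗ[k] k)
    (h : (antisymIdeal hR).restrictScalars k ≤ LinearMap.ker (extendByZero f)) :
    (TensorAlgebra k V ⧸ antisymIdeal hR) →ₗ[k] k :=
  ((antisymIdeal hR).restrictScalars k).liftQ (extendByZero f) h ∘ₗ
    (Submodule.Quotient.restrictScalarsEquiv k (antisymIdeal hR)).symm.toLinearMap

theorem quotFun_mk (hR : IsHeckeSymmetry R q) {n : ℕ} (f : tens k V n →ₗ[k] k)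
    (h : (antisymIdeal hR).restrictScalars k ≤ LinearMap.ker (extendByZero f))
    (x : TensorAlgebra k V) :
    quotFun hR f h (Ideal.Quotient.mk _ x) = extendByZero f x := rfl

theorem antisymIdeal_le_ker (hR : IsHeckeSymmetry R q) {n : ℕ}
    {f : tens k V n →ₗ[k] k}
    (hf : LinearMap.ker f = LinearMap.ker ((antisym R q n).domRestrict (tens k V n))) :
    (antisymIdeal hR).restrictScalars k ≤ LinearMap.ker (extendByZero f) := by
  intro x hx
  rw [Submodule.restrictScalars_mem, mem_antisymIdeal, totalAntisym_eq_zero_iff] at hx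
  have h1 := hx n
  rw [← extendByZero_eq_zero_iff hf (SetLike.coe_mem _), extendByZero_of_mem f (SetLike.coe_mem _)]
    at h1
  exact h1

theorem quotFun_separating (hR : IsHeckeSymmetry R q) {n : ℕ}
    (hvan : upsilon R q (n + 1) = ⊥) (hy : (tens k V n).map (antisym R q n) ≠ ⊥)
    {f : tens k V n →ₗ[k] k}
    (hf : LinearMap.ker f = LinearMap.ker ((antisym R q n).domRestrict (tens k V n)))
    (x : TensorAlgebra k V ⧸ antisymIdeal hR)
    (hx : ∀ y, quotFun hR f (antisymIdeal_le_ker hR hf) (x * y) = 0) : x = 0 := by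
  obtain ⟨u, rfl⟩ := Ideal.Quotient.mk_surjective x
  rw [Ideal.Quotient.eq_zero_iff_mem, mem_antisymIdeal_iff_radical hR hvan hy hf]
  intro i
  rw [mem_radical_iff]
  refine ⟨SetLike.coe_mem _, fun j hj w hw => ?_⟩
  rw [← extendByZero_mul hj f u hw]
  have := hx (Ideal.Quotient.mk _ w)
  rwa [← map_mul, quotFun_mk] at this

theorem isFrobenius_quot (hR : IsHeckeSymmetry R q) {n : ℕ}
    (h : ∀ i, (tens k V i).map (antisym R q i) = upsilon R q i)
    (hvan : upsilon R q (n + 1) = ⊥) (hy : (tens k V n).map (antisym R q n) ≠ ⊥)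
    {f : tens k V n →ₗ[k] k}
    (hf : LinearMap.ker f = LinearMap.ker ((antisym R q n).domRestrict (tens k V n))) :
    IsFrobenius k (TensorAlgebra k V ⧸ antisymIdeal hR) := by
  have := finiteDimensional_Upsilon hvan
  have hfd : FiniteDimensional k (TensorAlgebra k V ⧸ antisymIdeal hR) :=
    (quotEquivUpsilon hR h).symm.finiteDimensional
  exact ⟨hfd, quotFun hR f (antisymIdeal_le_ker hR hf), quotFun_separating hR hvan hy hf,
    separatingRight_of_separatingLeft (quotFun_separating hR hvan hy hf)⟩

/-! ### The Nakayama automorphism of `Υ(V,R)` -/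

/-- An automorphism of `T(V)/I'` which is a Nakayama automorphism for the function induced by `f`
is homogeneous of degree `0`. -/
theorem exists_mem_tens_nakayama (hR : IsHeckeSymmetry R q) {n : ℕ}
    (hvan : upsilon R q (n + 1) = ⊥) (hy : (tens k V n).map (antisym R q n) ≠ ⊥)
    {f : tens k V n →ₗ[k] k}
    (hf : LinearMap.ker f = LinearMap.ker ((antisym R q n).domRestrict (tens k V n)))
    {ν : (TensorAlgebra k V ⧸ antisymIdeal hR) ≃ₗ[k] (TensorAlgebra k V ⧸ antisymIdeal hR)}
    (hν : ∀ a b, quotFun hR f (antisymIdeal_le_ker hR hf) (b * a) =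
      quotFun hR f (antisymIdeal_le_ker hR hf) (ν a * b))
    {i : ℕ} {u : TensorAlgebra k V} (hu : u ∈ tens k V i) :
    ∃ u' ∈ tens k V i, ν (Ideal.Quotient.mk _ u) = Ideal.Quotient.mk _ u' ∧
      ∀ w, extendByZero f (w * u) = extendByZero f (u' * w) := by
  obtain ⟨z, hz⟩ := Ideal.Quotient.mk_surjective (ν (Ideal.Quotient.mk _ u))
  have hzw : ∀ w, extendByZero f (w * u) = extendByZero f (z * w) := by
    intro w
    have := hν (Ideal.Quotient.mk _ u) (Ideal.Quotient.mk _ w)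
    rwa [← hz, ← map_mul, ← map_mul, quotFun_mk, quotFun_mk] at this
  -- The component of z in a degree m ≠ i is in the radical: for w of degree n - m, f(zw) = f(wu)
  -- and wu does not have degree n.
  have hzu : ν (Ideal.Quotient.mk _ u) =
      Ideal.Quotient.mk _ (DirectSum.decompose (tens k V) z i : TensorAlgebra k V) := by
    rw [← hz, Ideal.Quotient.mk_eq_mk_iff_sub_mem, mem_antisymIdeal_iff_radical hR hvan hy hf]
    intro m
    rw [DirectSum.decompose_sub, DirectSum.sub_apply, DirectSum.decompose_coe, Submodule.coe_sub]
    by_cases hm : i = m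
    · subst hm
      rw [DirectSum.of_eq_same, sub_self]
      exact zero_mem _
    · rw [DirectSum.of_eq_of_ne _ _ _ (Ne.symm hm), Submodule.coe_zero, sub_zero, mem_radical_iff]
      refine ⟨SetLike.coe_mem _, fun j hj w hw => ?_⟩
      rw [← extendByZero_mul hj f z hw, ← hzw]
      exact extendByZero_of_mem_ne f (mul_mem_tens rfl hw hu) (by omega)
  refine ⟨_, SetLike.coe_mem (DirectSum.decompose (tens k V) z i), hzu, fun w => ?_⟩
  have := hν (Ideal.Quotient.mk _ u) (Ideal.Quotient.mk _ w)
  rwa [hzu, ← map_mul, ← map_mul, quotFun_mk, quotFun_mk] at this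

/-- The difference of two candidates at a ∈ Υ^{(i)} pairs to zero with y_{n-i}V^{⊗(n-i)}, hence
vanishes for i ≤ n; above n everything is 0. -/
theorem IsNakayama.unique (hR : IsHeckeSymmetry R q) {n : ℕ}
    (h : ∀ i, (tens k V i).map (antisym R q i) = upsilon R q i)
    (hvan : upsilon R q (n + 1) = ⊥) (hy : (tens k V n).map (antisym R q n) ≠ ⊥)
    {ν ν' : Upsilon R q ≃ₗ[k] Upsilon R q} (hν : IsNakayama R q n ν)
    (hν' : IsNakayama R q n ν') : ν' = ν := by
  suffices hcomp : ν'.toLinearMap ∘ₗ toUpsilon hR = ν.toLinearMap ∘ₗ toUpsilon hR by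
    ext1 a
    obtain ⟨x, rfl⟩ := toUpsilon_surjective hR h a
    exact LinearMap.congr_fun hcomp x
  refine linearMap_ext_tens fun i u hu => ?_
  change ν' (toUpsilon hR u) = ν (toUpsilon hR u)
  have ha : (toUpsilon hR u : TensorAlgebra k V) ∈ upsilon R q i := totalAntisym_mem_upsilon hR hu
  have h1 := hν.map_degree i _ ha
  have h2 := hν'.map_degree i _ ha
  obtain hi | hi := lt_or_ge n i
  · rw [upsilon_eq_bot hvan hi, Submodule.mem_bot] at h1 h2
    exact Subtype.ext (h2.trans h1.symm)
  · have hin : i + (n - i) = n := Nat.add_sub_cancel' hi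
    rw [← sub_eq_zero]
    ext1
    refine eq_zero_of_splitAntisym_eq_zero hR hvan hy hin (sub_mem h2 h1) fun w hw => ?_
    have hb := totalAntisym_mem_upsilon hR hw
    have h3 := hν.comm i hi (toUpsilon hR u) (toUpsilon hR w) ha hb
    have h4 := hν'.comm i hi (toUpsilon hR u) (toUpsilon hR w) ha hb
    rw [← totalAntisym_apply hw, Submodule.coe_sub, ← starMul_eq hin (upsilon_le_tens _ (sub_mem h2 h1))
      (upsilon_le_tens _ hb), map_sub, LinearMap.sub_apply, sub_eq_zero]
    exact h4.symm.trans h3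

theorem exists_isNakayama (hR : IsHeckeSymmetry R q) {n : ℕ}
    (h : ∀ i, (tens k V i).map (antisym R q i) = upsilon R q i)
    (hvan : upsilon R q (n + 1) = ⊥) (hy : (tens k V n).map (antisym R q n) ≠ ⊥)
    {f : tens k V n →ₗ[k] k}
    (hf : LinearMap.ker f = LinearMap.ker ((antisym R q n).domRestrict (tens k V n))) :
    ∃ ν : Upsilon R q ≃ₗ[k] Upsilon R q, IsNakayama R q n ν ∧
      ∀ v : V, ∃ v' : V, (ν ⟨TensorAlgebra.ι k v, ι_mem_Upsilon R q v⟩ : TensorAlgebra k V) =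
        TensorAlgebra.ι k v' ∧ ∀ w, extendByZero f (w * TensorAlgebra.ι k v) =
          extendByZero f (TensorAlgebra.ι k v' * w) := by
  have := finiteDimensional_Upsilon hvan
  let e := quotEquivUpsilon hR h
  have hfd : FiniteDimensional k (TensorAlgebra k V ⧸ antisymIdeal hR) :=
    e.symm.finiteDimensional
  obtain ⟨μ, hμ, hμ1, hμmul⟩ := exists_nakayama (quotFun_separating hR hvan hy hf)
  let ν : Upsilon R q ≃ₗ[k] Upsilon R q := e.symm ≪≫ₗ μ ≪≫ₗ e
  have hνe : ∀ a, ν (e a) = e (μ a) := fun a => by simp [ν]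
  have hmem : ∀ {i} {a : Upsilon R q}, (a : TensorAlgebra k V) ∈ upsilon R q i →
      ∃ u ∈ tens k V i, a = e (Ideal.Quotient.mk _ u) := by
    intro i a ha
    rw [← h i] at ha
    obtain ⟨u, hu, hua⟩ := ha
    exact ⟨u, hu, Subtype.ext (hua.symm.trans (totalAntisym_apply hu).symm)⟩
  refine ⟨ν, ⟨?_, ?_, ?_, ?_⟩, fun v => ?_⟩
  · rw [← quotEquivUpsilon_one hR h]
    change ν (e 1) = e 1
    rw [hνe, hμ1]
  · intro a b c hc
    obtain ⟨a, rfl⟩ := e.surjective a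
    obtain ⟨b, rfl⟩ := e.surjective b
    obtain rfl : c = e (a * b) := Subtype.ext (hc.trans (quotEquivUpsilon_mul hR h a b).symm)
    rw [hνe, hνe, hνe, hμmul]
    exact quotEquivUpsilon_mul hR h _ _
  · intro i a ha
    obtain ⟨u, hu, rfl⟩ := hmem ha
    obtain ⟨u', hu', hμu, -⟩ := exists_mem_tens_nakayama hR hvan hy hf hμ hu
    rw [hνe, hμu]
    exact totalAntisym_mem_upsilon hR hu'
  · intro i hi a b ha hb
    obtain ⟨u, hu, rfl⟩ := hmem ha
    obtain ⟨w, hw, rfl⟩ := hmem hb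
    obtain ⟨u', hu', hμu, huw⟩ := exists_mem_tens_nakayama hR hvan hy hf hμ hu
    rw [hνe, hμu]
    change starMul R q (totalAntisym R q w) (totalAntisym R q u) =
      starMul R q (totalAntisym R q u') (totalAntisym R q w)
    have h1 : w * u ∈ tens k V n := mul_mem_tens (Nat.sub_add_cancel hi) hw hu
    have h2 : u' * w ∈ tens k V n := mul_mem_tens (Nat.add_sub_cancel' hi) hu' hw
    -- Ker f = Ker y_n upgrades the scalar identity f(wu) = f(u'w) to an identity in Υ^{(n)}.
    rw [← totalAntisym_mul hR, ← totalAntisym_mul hR, totalAntisym_apply h1, totalAntisym_apply h2,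
      ← sub_eq_zero, ← map_sub, ← extendByZero_eq_zero_iff hf (sub_mem h1 h2), map_sub, huw,
      sub_self]
  · obtain ⟨u', hu', hμu, huw⟩ := exists_mem_tens_nakayama hR hvan hy hf hμ (ι_mem_tens v)
    obtain ⟨v', rfl⟩ := mem_tens_one hu'
    refine ⟨v', ?_, huw⟩
    have h1 : (⟨TensorAlgebra.ι k v, ι_mem_Upsilon R q v⟩ : Upsilon R q) =
        e (Ideal.Quotient.mk _ (TensorAlgebra.ι k v)) := Subtype.ext (totalAntisym_ι hR v).symm
    rw [h1, hνe, hμu]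
    exact totalAntisym_ι hR v'

theorem exists_equiv_nakayama {ν : Upsilon R q ≃ₗ[k] Upsilon R q}
    (h : ∀ v : V, ∃ v' : V,
      (ν ⟨TensorAlgebra.ι k v, ι_mem_Upsilon R q v⟩ : TensorAlgebra k V) =
        TensorAlgebra.ι k v') :
    ∃ φ : V ≃ₗ[k] V, ∀ v : V,
      (ν ⟨TensorAlgebra.ι k v, ι_mem_Upsilon R q v⟩ : TensorAlgebra k V) =
        TensorAlgebra.ι k (φ v) := by
  let φ₀ : V →ₗ[k] V := TensorAlgebra.ιInv ∘ₗ (Upsilon R q).subtype ∘ₗ ν.toLinearMap ∘ₗ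
    (TensorAlgebra.ι k).codRestrict (Upsilon R q) (ι_mem_Upsilon R q)
  have h0 : ∀ v, (ν ⟨TensorAlgebra.ι k v, ι_mem_Upsilon R q v⟩ : TensorAlgebra k V) =
      TensorAlgebra.ι k (φ₀ v) := by
    intro v
    obtain ⟨v', hv'⟩ := h v
    have h1 : φ₀ v = TensorAlgebra.ιInv (TensorAlgebra.ι k v') := by rw [← hv']; rfl
    rw [hv', h1, TensorAlgebra.ι_leftInverse]
  have hinj : Function.Injective φ₀ := by
    rw [injective_iff_map_eq_zero]
    intro v hv
    have h1 := h0 v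
    rw [hv, map_zero, Submodule.coe_eq_zero, map_eq_zero_iff _ ν.injective] at h1
    exact (TensorAlgebra.ι_eq_zero_iff k v).mp (congrArg Subtype.val h1)
  exact ⟨LinearEquiv.ofInjectiveEndo φ₀ hinj, h0⟩

/-- Up to degree n the q-factorials are invertible and put Ker y_m into I. Above n, [m]!_q may
vanish, and T_{n+1}(V) ⊆ I is used instead. -/
theorem antisymIdeal_eq_skewIdeal (hR : IsHeckeSymmetry R q) {n : ℕ} (hn : 0 < n)
    (hvan : upsilon R q (n + 1) = ⊥) (hy : (tens k V n).map (antisym R q n) ≠ ⊥)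
    {f : tens k V n →ₗ[k] k}
    (hf : LinearMap.ker f = LinearMap.ker ((antisym R q n).domRestrict (tens k V n)))
    (htw : ∀ v : V, ∃ v' : V, ∀ w, extendByZero f (w * TensorAlgebra.ι k v) =
      extendByZero f (TensorAlgebra.ι k v' * w)) (hq : qFactorial q n ≠ 0) :
    antisymIdeal hR = skewIdeal R q := by
  refine le_antisymm (fun x hx => ?_) (skewIdeal_le_antisymIdeal hR)
  have htop : ∀ x ∈ tens k V (n + 1), x ∈ skewIdeal R q := by
    obtain ⟨m, rfl⟩ := Nat.exists_eq_add_of_le' hn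
    refine fun x hx => tens_succ_le_skewIdeal hR hvan hq hy (extendByZero f)
      (fun x hx => extendByZero_eq_zero_iff hf hx)
      (fun v => (htw v).imp fun p hp w _ => hp w) (fun v hv => ?_) hx
    have h1 : TensorAlgebra.ι k v ∈ radical f 1 := by
      refine mem_radical_iff.mpr ⟨ι_mem_tens v, fun j hj w hw => hv w ?_⟩
      obtain rfl : j = m := by omega
      exact hw
    have h2 := ((mem_radical_iff_antisym hR hvan hy hf).mp h1).2
    rw [antisym_one_apply hR (ι_mem_tens v)] at h2
    exact (TensorAlgebra.ι_eq_zero_iff k v).mp h2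
  have hbig : ∀ d, ∀ x ∈ tens k V (n + 1 + d), x ∈ skewIdeal R q := fun d x hx =>
    tens_mul_induction (fun u hu w _ => Ideal.mul_mem_right _ _ (htop u hu))
      (fun x y hx hy => add_mem hx hy) hx
  rw [mem_antisymIdeal, totalAntisym_eq_zero_iff] at hx
  classical
  rw [← DirectSum.sum_support_decompose (tens k V) x]
  refine Ideal.sum_mem _ fun m _ => ?_
  obtain hm | hm := le_or_gt m n
  · exact mem_skewIdeal_of_antisym_eq_zero hR hm hq (SetLike.coe_mem _) (hx m)
  · obtain ⟨d, rfl⟩ := Nat.exists_eq_add_of_le (Nat.succ_le_of_lt hm)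
    exact hbig d _ (SetLike.coe_mem _)

end

end

end HeckeSym

/-! ### The theorem -/

open HeckeSym in
theorem proposition3p12 {k V : Type*} [Field k] [AddCommGroup V] [Module k V]
    [FiniteDimensional k V] (R : V ⊗[k] V →ₗ[k] V ⊗[k] V) (q : k) (hR : IsHeckeSymmetry R q)
    (n : ℕ) (hn : 0 < n) (hdim : Module.finrank k (upsilon R q n) = 1)
    (hvan : upsilon R q (n + 1) = ⊥)
    (hy : (tens k V n).map (antisym R q n) ≠ ⊥)
    (f : tens k V n →ₗ[k] k)
    (hf : LinearMap.ker f = LinearMap.ker ((antisym R q n).domRestrict (tens k V n))) :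
    -- the Nakayama automorphism `ν` of `Υ(V,R)`, its degree 1 part `φ`, and twisted cyclicity
    (∃ ν : Upsilon R q ≃ₗ[k] Upsilon R q, IsNakayama R q n ν ∧
      (∀ ν', IsNakayama R q n ν' → ν' = ν) ∧
      ∃ φ : V ≃ₗ[k] V,
        (∀ v : V, (ν ⟨TensorAlgebra.ι k v, ι_mem_Upsilon R q v⟩ : TensorAlgebra k V) =
          TensorAlgebra.ι k (φ v)) ∧
        ∀ (v : V) (w : tens k V (n - 1)),
          f ⟨w * TensorAlgebra.ι k v,
              mul_mem_tens (Nat.sub_add_cancel hn) w.2 (ι_mem_tens v)⟩ =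
            f ⟨TensorAlgebra.ι k (φ v) * w,
              mul_mem_tens (Nat.add_sub_cancel' hn) (ι_mem_tens (φ v)) w.2⟩) ∧
    -- the ideal `I'`
    radical f 0 = ⊥ ∧ radical f 1 = ⊥ ∧
    radical f 2 = (skewIdeal R q).restrictScalars k ⊓ tens k V 2 ∧
    ∃ (J : Ideal (TensorAlgebra k V)) (_ : J.IsTwoSided),
      J.restrictScalars k = radicalSum f ∧
      J.IsHomogeneous (tens k V) ∧
      IsFrobenius k (TensorAlgebra k V ⧸ J) ∧
      (∃ e : (TensorAlgebra k V ⧸ J) ≃ₗ[k] Upsilon R q, IsIsoUpsilon R q J e) ∧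
      (qFactorial q n ≠ 0 → J = skewIdeal R q) := by
  have hU := map_antisym_eq_upsilon hR hdim hvan hy
  have hrad := fun {i u} => mem_radical_iff_antisym (i := i) (u := u) hR hvan hy hf
  obtain ⟨ν, hν, hφ⟩ := exists_isNakayama hR hU hvan hy hf
  obtain ⟨φ, hνφ⟩ := exists_equiv_nakayama fun v => (hφ v).imp fun _ h => h.1
  refine ⟨⟨ν, hν, fun ν' hν' => hν.unique hR hU hvan hy hν', φ, hνφ, fun v w => ?_⟩, ?_, ?_, ?_,
    antisymIdeal hR, inferInstance, antisymIdeal_eq_radicalSum hR hvan hy hf,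
    antisymIdeal_isHomogeneous hR, isFrobenius_quot hR hU hvan hy hf,
    ⟨quotEquivUpsilon hR hU, isIsoUpsilon_quotEquivUpsilon hR hU⟩,
    antisymIdeal_eq_skewIdeal hR hn hvan hy hf fun v => (hφ v).imp fun _ h => h.2⟩
  · obtain ⟨v', h1, h2⟩ := hφ v
    obtain rfl : φ v = v' := TensorAlgebra.ι_leftInverse.injective ((hνφ v).symm.trans h1)
    rw [← extendByZero_of_mem, ← extendByZero_of_mem]
    exact h2 w
  · refine eq_bot_iff.mpr fun u hu => ?_
    simpa [antisym_zero] using (hrad.mp hu).2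
  · refine eq_bot_iff.mpr fun u hu => ?_
    have := hrad.mp hu
    rw [antisym_one_apply hR this.1] at this
    exact this.2
  · ext u
    rw [hrad, Submodule.mem_inf, and_comm, Submodule.restrictScalars_mem]
    exact and_congr_left fun hu => (mem_skewIdeal_of_mem_tens_two hR hu).symm
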